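/- Vectors in $\mathbb{R}^n$ carry the max norm, matrices the induced operator norm (maximal absolute row sum); inequalities between vectors or matrices are entrywise. Let $n,N\ge 1$, $m\ge 0$, $h>0$ and delays $0\le h^i\le h$ ($1\le i\le m$) be given (for instance $h=\max_i h^i>0$). For $A^0,A^i\in\mathbb{R}^{n\times n}$ and $B\in C([-h,0],\mathbb{R}^{n\times n})$ consider $$\dot x(t)=A^0x(t)+\sum_{i=1}^m A^i x(t-h^i)+\int_{-h}^0B(\theta)x(t+\theta)\,d\theta,\quad t\ge 0,\qquad x|_{[-h,0]}=\varphi\in C([-h,0],\mathbb{R}^n).\tag{1}$$ A system is *positive* if $\varphi\ge 0$ implies $x(t)\ge 0$ for all $t\ge 0$. It is *exponentially stable* if there are $M,\alpha>0$ with $\|x(t)\|\le Me^{-\alpha t}\|\varphi\|$ for all $t\ge0$ and all $\varphi$. A *switching signal* is a piecewise constant, right-continuous function $\sigma:[0,\infty)\to\{1,\dots,N\}$ with positive dwell time (its switching instants are separated by some $d>0$). Given $N$ systems with data $(A^0_k,A^i_k,B_k)$ and the same delays, the switched system is $$\dot x(t)=A^0_{\sigma(t)}x(t)+\sum_{i=1}^m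 A^i_{\sigma(t)} x(t-h^i)+\int_{-h}^0B_{\sigma(t)}(\theta)x(t+\theta)\,d\theta,\quad t\ge 0,\tag{2}$$ where the equation holds for the right derivative at switching instants. It is *exponentially stable under arbitrary switching* if the above estimate holds with $M,\alpha$ independent of $\varphi$ and of the switching signal $\sigma$. The delay terms of the $k$-th system are represented by the matrix function of bounded variation $$\eta_k(\theta)=\sum_{i=1}^m A^i_k\,\chi_{(-h^i,0]}(\theta)+\int_{-h}^\theta B_k(s)\,ds,\qquad \theta\in[-h,0],$$ as the Riemann–Stieltjes integral $\int_{-h}^0 d[\eta_k(\theta)]x(t+\theta)$ (for $h^i=0$ the function $\chi_{(-h^i,0]}$ is replaced by $\chi_{\{0\}}$). Let $NBV$ be the set of functions $\delta:[-h,0]\to\mathbb{R}^{n\times n}$ of bounded variation that are left-continuous on $(-h,0)$ with $\delta(-h)=0$, and let $\|\delta\|=\max_i\sum_j \mathrm{Var}([-h,0],\delta_{ij})$. The *real unstructured stability radius* $r_{\mathbb{R}}$ of (2) is the infimum of $$\max_{k}\big(\|\Delta_k\|+\|\delta_k\|\big),\qquad \Delta_k\in\mathbb{R}^{n\times n},\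 \delta_k\in NBV,$$ over all perturbations $A^0_k\to A^0_k+\Delta_k$, $\eta_k\to\eta_k+\delta_k$ for which there is a switching signal $\sigma$ such that the perturbed system is not exponentially stable. Let $r'_{\mathbb{R}}$ be the same infimum taken only over perturbations of the coefficients, $A^0_k\to A^0_k+\Delta^0_k$, $A^i_k\to A^i_k+\Delta^i_k$, $B_k\to B_k+C_k$ with $\Delta^0_k,\Delta^i_k\in\mathbb{R}^{n\times n}$, $C_k\in C([-h,0],\mathbb{R}^{n\times n})$, for which $\Delta_k=\Delta_k^0$ and $\delta_k(\theta)=\sum_{i=1}^m\Delta^i_k\chi_{(-h^i,0]}(\theta)+\int_{-h}^\theta C_k(s)\,ds$ (same convention for $h^i=0$). **Corollary.** Suppose that the system (1) with data $(A^0_0,A^i_0,B_0)$ is positive and exponentially stable. Let $(A^0_k,A^i_k,B_k)$, $k=1,\dots,N$, be data such that, for all $k$, $i$ and $\theta\in[-h,0]$, the off-diagonal entries of $A^0_k$ are nonnegative and $$A^0_k\le A^0_0,\qquad 0\le A^i_k\le A^i_0,\qquad 0\le B_k(\theta)\le B_0(\theta).$$ Then the switched positive system (2) is exponentially stable under arbitrary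 switching. Moreover, the matrices $H_k:=\sum_{i=0}^mA^i_k+\int_{-h}^0B_k(\theta)\,d\theta$, $k=0,1,\dots,N$, are invertible, and $$\frac1{\|H_0^{-1}\|}\le r_{\mathbb{R}}\le\frac1{\max_{1\le k\le N}\|H_k^{-1}\|},\qquad \frac1{\|H_0^{-1}\|}\le r'_{\mathbb{R}}\le\frac1{\max_{1\le k\le N}\|H_k^{-1}\|}.$$ -/

import Mathlib

open scoped Matrix.Norms.Operator

noncomputable section

namespace DelaySwitched

/- Vectors `Fin n → ℝ` carry the max norm, matrices the induced operator norm
(maximal absolute row sum), and `≤` on vectors is entrywise. -/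

/-! ### Solutions, stability, positivity -/

/-- `x` is a solution, with initial function `φ` on `[-h, 0]`, of the functional differential
equation `x'(t) = G t x_t`, `t ≥ 0`, where `x_t(θ) = x(t + θ)`: it is continuous on `[-h, ∞)`,
and the equation holds for the right derivative at every `t ≥ 0` (at a switching instant only
the one-sided derivatives exist). Only the values of `x_t` on `[-h, 0]` are used by the right-hand
sides `G` below. -/
structure IsSolution {n : ℕ} (h : ℝ) (G : ℝ → (ℝ → Fin n → ℝ) → (Fin n → ℝ))
    (φ : C(Set.Icc (-h) 0, Fin n → ℝ)) (x : ℝ → Fin n → ℝ) : Prop where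
  continuousOn : ContinuousOn x (Set.Ici (-h))
  initial : ∀ θ : Set.Icc (-h) (0 : ℝ), x θ = φ θ
  hasDeriv : ∀ t : ℝ, 0 ≤ t →
    HasDerivWithinAt x (G t (fun θ => x (t + θ))) (Set.Ici t) t

/-- The decay estimate with constants `M`, `α` for all solutions of `x'(t) = G t x_t`. -/
def HasDecay {n : ℕ} (h : ℝ) (G : ℝ → (ℝ → Fin n → ℝ) → (Fin n → ℝ)) (M α : ℝ) : Prop :=
  ∀ (φ : C(Set.Icc (-h) 0, Fin n → ℝ)) (x : ℝ → Fin n → ℝ), IsSolution h G φ x →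
    ∀ t : ℝ, 0 ≤ t → ‖x t‖ ≤ M * Real.exp (-α * t) * ‖φ‖

/-- Exponential stability of `x'(t) = G t x_t` (in particular, of a switched system under one
given switching signal). -/
def IsExpStable {n : ℕ} (h : ℝ) (G : ℝ → (ℝ → Fin n → ℝ) → (Fin n → ℝ)) : Prop :=
  ∃ M > 0, ∃ α > 0, HasDecay h G M α

/-- Positivity: nonnegative initial functions give nonnegative solutions. -/
def IsPositive {n : ℕ} (h : ℝ) (G : ℝ → (ℝ → Fin n → ℝ) → (Fin n → ℝ)) : Prop :=
  ∀ (φ : C(Set.Icc (-h) 0, Fin n → ℝ)) (x : ℝ → Fin n → ℝ), IsSolution h G φ x →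
    (∀ θ, 0 ≤ φ θ) → ∀ t : ℝ, 0 ≤ t → 0 ≤ x t

/-- Switching signals `[0, ∞) → {1, …, N}`: piecewise constant, right-continuous, with a positive
dwell time. (A signal with finitely many switches is covered by inserting instants `τ k` at which
the value does not change.) -/
def IsSwitchingSignal {N : ℕ} (σ : ℝ → Fin N) : Prop :=
  ∃ d > 0, ∃ τ : ℕ → ℝ, τ 0 = 0 ∧ (∀ k, d ≤ τ (k + 1) - τ k) ∧
    ∀ k, ∀ t ∈ Set.Ico (τ k) (τ (k + 1)), σ t = σ (τ k)

/-- Exponential stability under arbitrary switching of the switched system with subsystems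
`x'(t) = F k x_t`: the constants are uniform over all switching signals. -/
def IsExpStableArbitrarySwitching {n N : ℕ} (h : ℝ)
    (F : Fin N → (ℝ → Fin n → ℝ) → (Fin n → ℝ)) : Prop :=
  ∃ M > 0, ∃ α > 0, ∀ σ : ℝ → Fin N, IsSwitchingSignal σ → HasDecay h (fun t => F (σ t)) M α

/-! ### Functions of bounded variation and Riemann–Stieltjes integrals -/

/-- `I` is the Riemann–Stieltjes integral `∫_a^b f dψ`, as the limit of Riemann–Stieltjes sums
over tagged partitions of `[a, b]` as the mesh tends to zero. -/
def IsRSIntegral (a b : ℝ) (ψ f : ℝ → ℝ) (I : ℝ) : Prop :=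
  ∀ ε > 0, ∃ d > 0, ∀ (K : ℕ) (p c : ℕ → ℝ), p 0 = a → p K = b →
    (∀ i < K, p i ≤ c i ∧ c i ≤ p (i + 1) ∧ p (i + 1) - p i < d) →
    |∑ i ∈ Finset.range K, f (c i) * (ψ (p (i + 1)) - ψ (p i)) - I| < ε

open Classical in
/-- The Riemann–Stieltjes integral `∫_a^b f dψ`; it exists whenever `f` is continuous and `ψ` has
bounded variation on `[a, b]`. -/
def rsIntegral (a b : ℝ) (ψ f : ℝ → ℝ) : ℝ :=
  if hI : ∃ I, IsRSIntegral a b ψ f I then hI.choose else 0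

/-- Normalized matrix functions of bounded variation on `[-h, 0]`: they vanish at `-h` and are
left-continuous inside the interval. Continuity is not required at the end point `0`, so that
the evaluation functional `y ↦ y(0)` is represented too. -/
def IsNBV {n : ℕ} (h : ℝ) (δ : ℝ → Matrix (Fin n) (Fin n) ℝ) : Prop :=
  ∀ i j, BoundedVariationOn (fun θ => δ θ i j) (Set.Icc (-h) 0) ∧ δ (-h) i j = 0 ∧
    ∀ θ ∈ Set.Ioo (-h) 0, ContinuousWithinAt (fun s => δ s i j) (Set.Iic θ) θ

/-- The norm `max_i ∑_j Var([-h, 0], δ_ij)`. -/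
def nbvNorm {n : ℕ} (h : ℝ) (δ : ℝ → Matrix (Fin n) (Fin n) ℝ) : ℝ :=
  ⨆ i, ∑ j, (eVariationOn (fun θ => δ θ i j) (Set.Icc (-h) 0)).toReal

/-- The right-hand side `A y(0) + ∫_{-h}^0 d[η(θ)] y(θ)`. -/
def stieltjesRhs {n : ℕ} (h : ℝ) (A : Matrix (Fin n) (Fin n) ℝ)
    (η : ℝ → Matrix (Fin n) (Fin n) ℝ) (y : ℝ → Fin n → ℝ) : Fin n → ℝ :=
  A.mulVec (y 0) +
    fun i => ∑ j, rsIntegral (-h) 0 (fun θ => η θ i j) (fun θ => y θ j)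

/-- The real unstructured stability radius of the switched system `(A_k, η_k)`, with respect to
perturbations `A_k + Δ_k`, `η_k + δ_k` with arbitrary `Δ_k` and arbitrary normalized `δ_k` of
bounded variation, of size `max_k (‖Δ_k‖ + ‖δ_k‖)`. (For `n, N ≥ 1` the set is not empty.) -/
def stabilityRadius {n N : ℕ} (h : ℝ) (A : Fin N → Matrix (Fin n) (Fin n) ℝ)
    (η : Fin N → ℝ → Matrix (Fin n) (Fin n) ℝ) : ℝ :=
  sInf {ρ : ℝ | ∃ (Δ : Fin N → Matrix (Fin n) (Fin n) ℝ)
    (δ : Fin N → ℝ → Matrix (Fin n) (Fin n) ℝ), (∀ k, IsNBV h (δ k)) ∧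
    ρ = (⨆ k, (‖Δ k‖ + nbvNorm h (δ k))) ∧
    ∃ σ : ℝ → Fin N, IsSwitchingSignal σ ∧
      ¬ IsExpStable h (fun t => stieltjesRhs h (A (σ t) + Δ (σ t)) (η (σ t) + δ (σ t)))}

/-! ### Systems with discrete and distributed delays -/

/-- The coefficients of a linear system with `m` discrete delays and a distributed delay. -/
structure DelayData (n m : ℕ) where
  A0 : Matrix (Fin n) (Fin n) ℝ
  A : Fin m → Matrix (Fin n) (Fin n) ℝ
  B : ℝ → Matrix (Fin n) (Fin n) ℝ

namespace DelayData

variable {n m : ℕ}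

/-- The kernel `B` of the distributed delay is continuous on `[-h, 0]`. -/
def IsContinuous (h : ℝ) (D : DelayData n m) : Prop :=
  ∀ i j, ContinuousOn (fun θ => D.B θ i j) (Set.Icc (-h) 0)

/-- Adding a perturbation to the coefficients. -/
def perturb (D P : DelayData n m) : DelayData n m where
  A0 := D.A0 + P.A0
  A := D.A + P.A
  B := D.B + P.B

/-- The right-hand side `A⁰ y(0) + ∑ᵢ Aⁱ y(-rᵢ) + ∫_{-h}^0 B(θ) y(θ) dθ`. -/
def rhs (h : ℝ) (r : Fin m → ℝ) (D : DelayData n m) (y : ℝ → Fin n → ℝ) : Fin n → ℝ :=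
  D.A0.mulVec (y 0) + ∑ i, (D.A i).mulVec (y (-r i)) +
    ∫ θ in (-h)..0, (D.B θ).mulVec (y θ)

/-- The matrix function `η(θ) = ∑ᵢ Aⁱ χ_{(-rᵢ, 0]}(θ) + ∫_{-h}^θ B(s) ds` of bounded variation
which represents the delay terms; a delay `rᵢ = 0` is represented by the jump `Aⁱ` at `θ = 0`. -/
def kernel (h : ℝ) (r : Fin m → ℝ) (D : DelayData n m) (θ : ℝ) : Matrix (Fin n) (Fin n) ℝ :=
  (∑ i, (if -r i < θ ∨ θ = 0 then (1 : ℝ) else 0) • D.A i) +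
    Matrix.of fun a b => ∫ s in (-h)..θ, D.B s a b

/-- The matrix `H = A⁰ + ∑ᵢ Aⁱ + ∫_{-h}^0 B(θ) dθ`. -/
def H (h : ℝ) (D : DelayData n m) : Matrix (Fin n) (Fin n) ℝ :=
  D.A0 + ∑ i, D.A i + Matrix.of fun a b => ∫ θ in (-h)..0, D.B θ a b

/-- `D` is positive (`A⁰` is Metzler, `Aⁱ ≥ 0`, `B ≥ 0`) and entrywise dominated by `D'`. -/
structure IsDominatedBy (h : ℝ) (D D' : DelayData n m) : Prop where
  metzler : ∀ a b, a ≠ b → 0 ≤ D.A0 a b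
  A0_le : ∀ a b, D.A0 a b ≤ D'.A0 a b
  A_nonneg : ∀ i a b, 0 ≤ D.A i a b
  A_le : ∀ i a b, D.A i a b ≤ D'.A i a b
  B_nonneg : ∀ θ ∈ Set.Icc (-h) 0, ∀ a b, 0 ≤ D.B θ a b
  B_le : ∀ θ ∈ Set.Icc (-h) 0, ∀ a b, D.B θ a b ≤ D'.B θ a b

/-- The real unstructured stability radius of the switched delay system with respect to
perturbations of its coefficients only: `A⁰_k + Δ⁰_k`, `Aⁱ_k + Δⁱ_k`, `B_k + C_k` with continuous
`C_k`, of size `max_k (‖Δ⁰_k‖ + ‖δ_k‖)`, where `δ_k` is the function of bounded variation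
representing `(Δⁱ_k, C_k)`. (For `n, N ≥ 1` the set is not empty.) -/
def coefficientRadius {N : ℕ} (h : ℝ) (r : Fin m → ℝ) (D : Fin N → DelayData n m) : ℝ :=
  sInf {ρ : ℝ | ∃ P : Fin N → DelayData n m, (∀ k, (P k).IsContinuous h) ∧
    ρ = (⨆ k, (‖(P k).A0‖ + nbvNorm h ((P k).kernel h r))) ∧
    ∃ σ : ℝ → Fin N, IsSwitchingSignal σ ∧
      ¬ IsExpStable h (fun t => ((D (σ t)).perturb (P (σ t))).rhs h r)}

end DelayData

end DelaySwitched

end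

noncomputable section

namespace DelaySwitched

/-! ### Riemann–Stieltjes integrals -/

/-! Everything rests on the vector `p = (-H₀)⁻¹ 1`: it is strictly positive, `H₀ p = -1`, and since
`(-H₀)⁻¹ ≥ 0` its max norm is `‖H₀⁻¹‖`.

Such a `p` exists because a real root `lam ≥ 0` of the characteristic equation of the dominating
system would give a non-decaying solution `e^{lam t} v`. Hence `lam I - symbol(lam)` is a
nonsingular Z-matrix for all `lam ≥ 0`; its inverse is nonnegative for large `lam`, and this
persists down to `lam = 0` (`inv_nonneg_of_path`, `DelayData.neg_H_inv_nonneg`).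

For small `α > 0` the boxes `|x_i| ≤ C e^{-αt} p_i` trap every solution: at a face, domination
bounds the outward velocity by that of the dominating system at `C e^{-αt} p`, about `-C e^{-αt}`.
This is a pointwise statement in time, so the switching signal plays no role, and it survives
perturbations of size `ρ` with `ρ ‖p‖ < 1` (`hasDecay_of_inward`, `exists_uniform_decay`). The case
`ρ = 0` is stability under arbitrary switching; the general case is the lower bound `1 / ‖p‖` for
both radii.

For the upper bounds, `(-H_k) p ≥ 1` makes each `-H_k` a nonsingular M-matrix. A rank-one change of
`A⁰_k` of norm `1 / ‖H_k⁻¹‖` then makes `H_k` singular, and the perturbed subsystem has a nonzero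
constant solution (`exists_singular_perturbation`).

The Stieltjes theory supplies existence, additivity in the integrator and the total variation bound,
so that a perturbation splits off the nominal right-hand side. -/

lemma partition_mem {a b d : ℝ} {K : ℕ} {p c : ℕ → ℝ} (h0 : p 0 = a) (hK : p K = b)
    (h : ∀ i < K, p i ≤ c i ∧ c i ≤ p (i + 1) ∧ p (i + 1) - p i < d) :
    MonotoneOn p (Set.Icc 0 K) ∧ ∀ i ≤ K, p i ∈ Set.Icc a b := by
  have hm : ∀ j ≤ K, ∀ i ≤ j, p i ≤ p j := by
    intro j
    induction j with
    | zero => intro _ i hi; rw [Nat.le_zero.1 hi]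
    | succ j ih =>
      intro hj i hi
      rcases Nat.le_succ_iff.1 hi with hi | rfl
      · exact (ih (by omega) i hi).trans ((h j (by omega)).1.trans (h j (by omega)).2.1)
      · exact le_rfl
  refine ⟨fun i hi j hj hij => hm j hj.2 i hij, fun i hi => ⟨?_, ?_⟩⟩
  · rw [← h0]; exact hm i hi 0 (Nat.zero_le _)
  · rw [← hK]; exact hm K le_rfl i hi

/-- The error on each cell is charged to the increment of the monotone `V`; both `J` and `V`
telescope. The existence result and the two explicit integrals below are instances. -/
lemma isRSIntegral_of_approx {a b : ℝ} {ψ f V J : ℝ → ℝ} (hab : a ≤ b)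
    (hV : MonotoneOn V (Set.Icc a b))
    (hJ : ∀ ε > 0, ∃ d > 0, ∀ u v c, u ∈ Set.Icc a b → v ∈ Set.Icc a b → u ≤ c → c ≤ v →
      v - u < d → |f c * (ψ v - ψ u) - (J v - J u)| ≤ ε * (V v - V u)) :
    IsRSIntegral a b ψ f (J b - J a) := by
  intro ε hε
  have hVab : V a ≤ V b := hV ⟨le_rfl, hab⟩ ⟨hab, le_rfl⟩ hab
  -- The `+ 1` allows `V b = V a` and makes the final inequality strict.
  obtain ⟨d, hd, H⟩ := hJ (ε / (V b - V a + 1)) (by apply div_pos hε; linarith)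
  refine ⟨d, hd, fun K p c h0 hK h => ?_⟩
  obtain ⟨-, hmem⟩ := partition_mem h0 hK h
  have hJs : J b - J a = ∑ i ∈ Finset.range K, (J (p (i + 1)) - J (p i)) := by
    rw [Finset.sum_range_sub (fun i => J (p i)), h0, hK]
  have hVs : V b - V a = ∑ i ∈ Finset.range K, (V (p (i + 1)) - V (p i)) := by
    rw [Finset.sum_range_sub (fun i => V (p i)), h0, hK]
  rw [hJs, ← Finset.sum_sub_distrib]
  calc _ ≤ ∑ i ∈ Finset.range K, |f (c i) * (ψ (p (i + 1)) - ψ (p i)) -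
          (J (p (i + 1)) - J (p i))| := Finset.abs_sum_le_sum_abs _ _
    _ ≤ ∑ i ∈ Finset.range K, ε / (V b - V a + 1) * (V (p (i + 1)) - V (p i)) := by
        refine Finset.sum_le_sum fun i hi => ?_
        have hi := Finset.mem_range.1 hi
        exact H _ _ _ (hmem i hi.le) (hmem _ hi) (h i hi).1 (h i hi).2.1 (h i hi).2.2
    _ = ε * ((V b - V a) / (V b - V a + 1)) := by
        rw [← Finset.mul_sum, ← hVs]; ring
    _ < ε * 1 := by
        apply mul_lt_mul_of_pos_left _ hε
        rw [div_lt_one (by linarith)]; linarith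
    _ = ε := mul_one ε

lemma exists_fine_partition {a b : ℝ} (hab : a ≤ b) {d : ℝ} (hd : 0 < d) :
    ∃ (K : ℕ) (p : ℕ → ℝ), p 0 = a ∧ p K = b ∧
      ∀ i < K, p i ≤ p i ∧ p i ≤ p (i + 1) ∧ p (i + 1) - p i < d := by
  obtain ⟨K, hK⟩ := exists_nat_gt ((b - a) / d)
  have hK0 : (0 : ℝ) < K := lt_of_le_of_lt (div_nonneg (by linarith) hd.le) hK
  refine ⟨K, fun i => a + i * ((b - a) / K), by simp, by field_simp; ring, fun i _ => ?_⟩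
  have : 0 ≤ (b - a) / K := div_nonneg (by linarith) hK0.le
  have h2 : (b - a) / K < d := by
    rw [div_lt_iff₀ hd] at hK
    rw [div_lt_iff₀ hK0]; linarith
  push_cast
  refine ⟨le_rfl, ?_, ?_⟩ <;> nlinarith

lemma IsRSIntegral.unique {a b : ℝ} {ψ f : ℝ → ℝ} {I I' : ℝ} (hab : a ≤ b)
    (hI : IsRSIntegral a b ψ f I) (hI' : IsRSIntegral a b ψ f I') : I = I' := by
  refine eq_of_forall_dist_le fun ε hε => ?_
  obtain ⟨d, hd, h⟩ := hI (ε / 2) (half_pos hε)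
  obtain ⟨d', hd', h'⟩ := hI' (ε / 2) (half_pos hε)
  obtain ⟨K, p, h0, hK, hp⟩ := exists_fine_partition hab (lt_min hd hd')
  have h1 := abs_lt.1 (h K p p h0 hK
    fun i hi => ⟨(hp i hi).1, (hp i hi).2.1, (hp i hi).2.2.trans_le (min_le_left _ _)⟩)
  have h2 := abs_lt.1 (h' K p p h0 hK
    fun i hi => ⟨(hp i hi).1, (hp i hi).2.1, (hp i hi).2.2.trans_le (min_le_right _ _)⟩)
  rw [Real.dist_eq, abs_le]
  constructor <;> linarith

lemma IsRSIntegral.rsIntegral_eq {a b : ℝ} {ψ f : ℝ → ℝ} {I : ℝ} (hab : a ≤ b)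
    (hI : IsRSIntegral a b ψ f I) : rsIntegral a b ψ f = I := by
  have h : ∃ I, IsRSIntegral a b ψ f I := ⟨I, hI⟩
  rw [rsIntegral, dif_pos h]
  exact h.choose_spec.unique hab hI

lemma IsRSIntegral.add {a b : ℝ} {ψ χ f : ℝ → ℝ} {I J : ℝ}
    (hI : IsRSIntegral a b ψ f I) (hJ : IsRSIntegral a b χ f J) :
    IsRSIntegral a b (fun x => ψ x + χ x) f (I + J) := by
  intro ε hε
  obtain ⟨d, hd, h⟩ := hI (ε / 2) (half_pos hε)
  obtain ⟨d', hd', h'⟩ := hJ (ε / 2) (half_pos hε)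
  refine ⟨min d d', lt_min hd hd', fun K p c h0 hK hp => ?_⟩
  have h1 := abs_lt.1 (h K p c h0 hK
    fun i hi => ⟨(hp i hi).1, (hp i hi).2.1, (hp i hi).2.2.trans_le (min_le_left _ _)⟩)
  have h2 := abs_lt.1 (h' K p c h0 hK
    fun i hi => ⟨(hp i hi).1, (hp i hi).2.1, (hp i hi).2.2.trans_le (min_le_right _ _)⟩)
  have e : ∑ i ∈ Finset.range K, f (c i) * (ψ (p (i + 1)) + χ (p (i + 1)) - (ψ (p i) + χ (p i)))
      = ∑ i ∈ Finset.range K, f (c i) * (ψ (p (i + 1)) - ψ (p i)) +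
        ∑ i ∈ Finset.range K, f (c i) * (χ (p (i + 1)) - χ (p i)) := by
    rw [← Finset.sum_add_distrib]
    exact Finset.sum_congr rfl fun i _ => by ring
  rw [e, abs_lt]
  constructor <;> linarith

lemma IsRSIntegral.mul_const {a b : ℝ} {ψ f : ℝ → ℝ} {I : ℝ}
    (hI : IsRSIntegral a b ψ f I) (C : ℝ) :
    IsRSIntegral a b (fun x => ψ x * C) f (C * I) := by
  intro ε hε
  obtain ⟨d, hd, h⟩ := hI (ε / (|C| + 1)) (by positivity)
  refine ⟨d, hd, fun K p c h0 hK hp => ?_⟩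
  have h1 := h K p c h0 hK hp
  have e : ∑ i ∈ Finset.range K, f (c i) * (ψ (p (i + 1)) * C - ψ (p i) * C)
      = C * ∑ i ∈ Finset.range K, f (c i) * (ψ (p (i + 1)) - ψ (p i)) := by
    rw [Finset.mul_sum]
    exact Finset.sum_congr rfl fun i _ => by ring
  rw [e, ← mul_sub, abs_mul]
  rw [lt_div_iff₀ (by positivity)] at h1
  nlinarith [abs_nonneg C, abs_nonneg (∑ i ∈ Finset.range K, f (c i) * (ψ (p (i + 1)) - ψ (p i)) - I)]

lemma isRSIntegral_zero (a b : ℝ) (f : ℝ → ℝ) : IsRSIntegral a b (fun _ => 0) f 0 :=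
  fun ε hε => ⟨1, one_pos, fun K p c _ _ _ => by simpa using hε⟩

lemma IsRSIntegral.sum {ι : Type*} {a b : ℝ} {f : ℝ → ℝ} (s : Finset ι) {ψ : ι → ℝ → ℝ}
    {I : ι → ℝ} (hI : ∀ i ∈ s, IsRSIntegral a b (ψ i) f (I i)) :
    IsRSIntegral a b (fun x => ∑ i ∈ s, ψ i x) f (∑ i ∈ s, I i) := by
  classical
  induction s using Finset.induction_on with
  | empty => simpa using isRSIntegral_zero a b f
  | insert i s hi ih =>
    simp only [Finset.sum_insert hi]
    exact (hI i (Finset.mem_insert_self i s)).add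
      (ih fun j hj => hI j (Finset.mem_insert_of_mem hj))

lemma exists_modulus {a b : ℝ} {f : ℝ → ℝ} (hf : ContinuousOn f (Set.Icc a b)) {ε : ℝ}
    (hε : 0 < ε) : ∃ d > 0, ∀ x ∈ Set.Icc a b, ∀ y ∈ Set.Icc a b, |x - y| < d →
      |f x - f y| ≤ ε := by
  have := isCompact_Icc.uniformContinuousOn_of_continuous hf
  obtain ⟨d, hd, h⟩ := Metric.uniformContinuousOn_iff.1 this ε hε
  exact ⟨d, hd, fun x hx y hy hxy => (h x hx y hy hxy).le⟩

/-- A continuous function is Riemann–Stieltjes integrable with respect to a monotone one. -/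
lemma exists_isRSIntegral_of_monotoneOn {a b : ℝ} {ψ f : ℝ → ℝ} (hab : a ≤ b)
    (hψ : MonotoneOn ψ (Set.Icc a b)) (hf : ContinuousOn f (Set.Icc a b)) :
    ∃ I, IsRSIntegral a b ψ f I := by
  have haI : a ∈ Set.Icc a b := ⟨le_rfl, hab⟩
  have hbI : b ∈ Set.Icc a b := ⟨hab, le_rfl⟩
  -- the generalized inverse of `ψ`
  let S : ℝ → Set ℝ := fun u => {x | x ∈ Set.Icc a b ∧ (x = a ∨ ψ x ≤ u)}
  let g : ℝ → ℝ := fun u => sSup (S u)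
  -- The disjunct `x = a` keeps `S u` nonempty for every `u`, so `sSup` never takes its default
  -- value.
  have hSa : ∀ u, a ∈ S u := fun u => ⟨haI, Or.inl rfl⟩
  have hSb : ∀ u, BddAbove (S u) := fun u => ⟨b, fun x hx => hx.1.2⟩
  have hg : Monotone g := fun u v huv =>
    csSup_le_csSup (hSb v) ⟨a, hSa u⟩ fun x hx => ⟨hx.1, hx.2.imp_right fun h => h.trans huv⟩
  have hgmem : ∀ u, g u ∈ Set.Icc a b := fun u =>
    ⟨le_csSup (hSb u) (hSa u), csSup_le ⟨a, hSa u⟩ fun x hx => hx.1.2⟩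
  have hgI : ∀ u v, u ∈ Set.Icc a b → v ∈ Set.Icc a b → ∀ s ∈ Set.Ioo (ψ u) (ψ v),
      g s ∈ Set.Icc u v := by
    intro u v hu hv s hs
    refine ⟨le_csSup (hSb s) ⟨hu, Or.inr hs.1.le⟩, csSup_le ⟨a, hSa s⟩ fun x hx => ?_⟩
    rcases hx.2 with rfl | hx2
    · exact hv.1
    · by_contra hlt
      exact absurd (hψ hv hx.1 (not_le.1 hlt).le) (not_le.2 (hx2.trans_lt hs.2))
  obtain ⟨M, hM⟩ := isCompact_Icc.exists_bound_of_continuousOn hf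
  let F : ℝ → ℝ := fun u => f (g u)
  have hFm : Measurable F := by
    have : F = (Set.Icc a b).domRestrict f ∘ fun u => (⟨g u, hgmem u⟩ : Set.Icc a b) := rfl
    rw [this]
    exact (continuousOn_iff_continuous_domRestrict.1 hf).measurable.comp
      (hg.measurable.subtype_mk)
  have hFi : ∀ u v, IntervalIntegrable F MeasureTheory.volume u v := fun u v =>
    (intervalIntegrable_const (c := M)).mono_fun hFm.aestronglyMeasurable
      (Filter.Eventually.of_forall fun x => (hM _ (hgmem x)).trans (le_abs_self M))
  -- Change of variables: `∫ f dψ` is the Lebesgue integral of `f ∘ g` over `[ψ a, ψ b]`, and jumps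
  -- of `ψ` become intervals on which `g` is constant.
  refine ⟨_, isRSIntegral_of_approx (V := ψ) (J := fun x => ∫ u in (ψ a)..(ψ x), F u) hab hψ ?_⟩
  intro ε hε
  obtain ⟨d, hd, hmod⟩ := exists_modulus hf hε
  refine ⟨d, hd, fun u v c hu hv huc hcv hvu => ?_⟩
  have huv := hψ hu hv (huc.trans hcv)
  have hc : c ∈ Set.Icc a b := ⟨hu.1.trans huc, hcv.trans hv.2⟩
  have e : f c * (ψ v - ψ u) - ((∫ s in (ψ a)..(ψ v), F s) - ∫ s in (ψ a)..(ψ u), F s) =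
      ∫ s in (ψ u)..(ψ v), (f c - F s) := by
    rw [intervalIntegral.integral_interval_sub_left (hFi _ _) (hFi _ _),
      intervalIntegral.integral_sub intervalIntegrable_const (hFi _ _)]
    simp [mul_comm]
  -- `g s ∈ [u, v]` is only known for `s` strictly between `ψ u` and `ψ v`, hence the open interval.
  rw [e, ← Real.norm_eq_abs, intervalIntegral.integral_of_le huv,
    MeasureTheory.integral_Ioc_eq_integral_Ioo]
  have := MeasureTheory.norm_setIntegral_le_of_norm_le_const (μ := MeasureTheory.volume)
    (s := Set.Ioo (ψ u) (ψ v)) (f := fun s => f c - F s) (C := ε) (by simp) ?_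
  · simpa [MeasureTheory.measureReal_def, huv] using this
  · intro s hs
    have hgs := hgI u v hu hv s hs
    refine hmod c hc (g s) (hgmem s) ?_
    rw [abs_lt]; constructor <;> linarith [hgs.1, hgs.2]

/-- A continuous function is Riemann–Stieltjes integrable with respect to one of bounded
variation. -/
lemma exists_isRSIntegral {a b : ℝ} {ψ f : ℝ → ℝ} (hab : a ≤ b)
    (hψ : BoundedVariationOn ψ (Set.Icc a b)) (hf : ContinuousOn f (Set.Icc a b)) :
    ∃ I, IsRSIntegral a b ψ f I := by
  obtain ⟨p, q, hp, hq, rfl⟩ := hψ.locallyBoundedVariationOn.exists_monotoneOn_sub_monotoneOn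
  obtain ⟨I, hI⟩ := exists_isRSIntegral_of_monotoneOn hab hp hf
  obtain ⟨J, hJ⟩ := exists_isRSIntegral_of_monotoneOn hab hq hf
  refine ⟨I + -1 * J, ?_⟩
  convert hI.add (hJ.mul_const (-1)) using 1
  ext x
  simp [sub_eq_add_neg]

lemma IsRSIntegral.abs_le {a b : ℝ} {ψ f : ℝ → ℝ} {I M : ℝ} (hab : a ≤ b)
    (hψ : BoundedVariationOn ψ (Set.Icc a b)) (hM : ∀ x ∈ Set.Icc a b, |f x| ≤ M)
    (hI : IsRSIntegral a b ψ f I) :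
    |I| ≤ (eVariationOn ψ (Set.Icc a b)).toReal * M := by
  have hM0 : 0 ≤ M := (abs_nonneg _).trans (hM a ⟨le_rfl, hab⟩)
  refine le_of_forall_pos_le_add fun ε hε => ?_
  obtain ⟨d, hd, h⟩ := hI ε hε
  obtain ⟨K, p, h0, hK, hp⟩ := exists_fine_partition hab hd
  obtain ⟨hmono, hmem⟩ := partition_mem h0 hK hp
  have h1 := h K p p h0 hK hp
  have hvar : ∑ i ∈ Finset.range K, |ψ (p (i + 1)) - ψ (p i)| ≤
      (eVariationOn ψ (Set.Icc a b)).toReal := by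
    have := eVariationOn.sum_le_of_monotoneOn_Icc (f := ψ) hmono fun i hi => hmem i hi.2
    rw [← Finset.range_eq_Ico] at this
    have h2 := ENNReal.toReal_mono hψ this
    rw [ENNReal.toReal_sum fun i _ => edist_ne_top _ _] at h2
    simpa [edist_dist, Real.dist_eq] using h2
  have hs : |∑ i ∈ Finset.range K, f (p i) * (ψ (p (i + 1)) - ψ (p i))| ≤
      (eVariationOn ψ (Set.Icc a b)).toReal * M := by
    calc _ ≤ ∑ i ∈ Finset.range K, |f (p i) * (ψ (p (i + 1)) - ψ (p i))| :=
          Finset.abs_sum_le_sum_abs _ _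
      _ ≤ ∑ i ∈ Finset.range K, |ψ (p (i + 1)) - ψ (p i)| * M := by
          refine Finset.sum_le_sum fun i hi => ?_
          rw [abs_mul, mul_comm]
          exact mul_le_mul_of_nonneg_left (hM _ (hmem i (Finset.mem_range.1 hi).le))
            (abs_nonneg _)
      _ ≤ _ := by
          rw [← Finset.sum_mul]
          exact mul_le_mul_of_nonneg_right hvar hM0
  have := abs_sub_abs_le_abs_sub I (∑ i ∈ Finset.range K, f (p i) * (ψ (p (i + 1)) - ψ (p i)))
  rw [abs_sub_comm] at this
  linarith

/-- Bounded variation from a bound of the increments by those of a monotone function. -/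
lemma boundedVariationOn_of_abs_sub_le {a b : ℝ} {ψ V : ℝ → ℝ} (hab : a ≤ b)
    (hV : MonotoneOn V (Set.Icc a b))
    (h : ∀ u ∈ Set.Icc a b, ∀ v ∈ Set.Icc a b, u ≤ v → |ψ v - ψ u| ≤ V v - V u) :
    BoundedVariationOn ψ (Set.Icc a b) := by
  have hle : eVariationOn ψ (Set.Icc a b) ≤ eVariationOn V (Set.Icc a b) := by
    refine iSup_mono fun p => Finset.sum_le_sum fun i _ => ?_
    rw [edist_dist, edist_dist, Real.dist_eq, Real.dist_eq]
    refine ENNReal.ofReal_le_ofReal ?_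
    exact (h _ (p.2.2.2 i) _ (p.2.2.2 (i + 1)) (p.2.2.1 (Nat.le_succ i))).trans (le_abs_self _)
  have := hV.eVariationOn_eq ⟨le_rfl, hab⟩ ⟨hab, le_rfl⟩
  rw [Set.inter_self] at this
  exact ne_top_of_le_ne_top ENNReal.ofReal_ne_top (hle.trans this.le)

/-- The function `χ_{(-r, 0]}` (`χ_{0}` for `r = 0`). -/
def delayStep (r θ : ℝ) : ℝ := if -r < θ ∨ θ = 0 then 1 else 0

lemma delayStep_monotoneOn {h r : ℝ} : MonotoneOn (delayStep r) (Set.Icc (-h) 0) := by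
  intro u hu v hv huv
  unfold delayStep
  split_ifs with h1 h2 <;> try norm_num
  apply h2
  rcases h1 with h1 | h1
  · exact Or.inl (h1.trans_le huv)
  · exact Or.inr (le_antisymm hv.2 (h1 ▸ huv))

/-- Only a cell on which the step increases contributes; it contains `-r`, so its tag is close to
`-r`. The step vanishes at `-h` even for `r = h`, and the clause `θ = 0` supplies the jump for `r =
0`. -/
lemma isRSIntegral_delayStep {h r : ℝ} (hh : 0 < h) (hr : 0 ≤ r ∧ r ≤ h) {f : ℝ → ℝ}
    (hf : ContinuousOn f (Set.Icc (-h) 0)) :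
    IsRSIntegral (-h) 0 (delayStep r) f (f (-r)) := by
  have hm := delayStep_monotoneOn (h := h) (r := r)
  have e : f (-r) = f (-r) * delayStep r 0 - f (-r) * delayStep r (-h) := by
    have h1 : ¬ (-r < -h ∨ -h = 0) := by
      rintro (h1 | h1) <;> linarith [hr.2]
    rw [delayStep, delayStep, if_neg h1, if_pos (Or.inr rfl)]
    ring
  rw [e]
  refine isRSIntegral_of_approx (V := delayStep r) (J := fun x => f (-r) * delayStep r x)
    (by linarith) hm fun ε hε => ?_
  obtain ⟨d, hd, hmod⟩ := exists_modulus hf hε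
  refine ⟨d, hd, fun u v c hu hv huc hcv hvu => ?_⟩
  have hle := hm hu hv (huc.trans hcv)
  rw [← mul_sub, ← sub_mul, abs_mul, abs_of_nonneg (sub_nonneg.2 hle)]
  rcases hle.eq_or_lt with heq | hlt
  · simp [heq]
  refine mul_le_mul_of_nonneg_right ?_ (sub_nonneg.2 hle)
  refine hmod c ⟨hu.1.trans huc, hcv.trans hv.2⟩ _ ⟨by linarith, by linarith⟩ ?_
  have h1 : u ≤ -r ∧ -r ≤ v := by
    unfold delayStep at hlt
    split_ifs at hlt with hu' hv' hv'
    · norm_num at hlt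
    · norm_num at hlt
    · push Not at hu'
      refine ⟨hu'.1, ?_⟩
      rcases hv' with h | h <;> linarith
    · norm_num at hlt
  rw [abs_lt]; constructor <;> linarith

/-- The error on a cell is `∫ β(s) (f(c) - f(s)) ds`, at most `M ε` times its length, whence `V x =
M x`. -/
lemma isRSIntegral_primitive {a b : ℝ} (hab : a ≤ b) {β f : ℝ → ℝ}
    (hβ : ContinuousOn β (Set.Icc a b)) (hf : ContinuousOn f (Set.Icc a b)) :
    IsRSIntegral a b (fun x => ∫ s in a..x, β s) f (∫ s in a..b, β s * f s) := by
  obtain ⟨M, hM⟩ := isCompact_Icc.exists_bound_of_continuousOn hβ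
  have hM0 : 0 ≤ M := (norm_nonneg _).trans (hM a ⟨le_rfl, hab⟩)
  have hint : ∀ {φ : ℝ → ℝ}, ContinuousOn φ (Set.Icc a b) → ∀ u ∈ Set.Icc a b,
      ∀ v ∈ Set.Icc a b, IntervalIntegrable φ MeasureTheory.volume u v :=
    fun hφ u hu v hv => (hφ.mono (Set.uIcc_subset_Icc hu hv)).intervalIntegrable
  have haI : a ∈ Set.Icc a b := ⟨le_rfl, hab⟩
  have hβf : ContinuousOn (fun s => β s * f s) (Set.Icc a b) := hβ.mul hf
  have key := isRSIntegral_of_approx (f := f) (ψ := fun x => ∫ s in a..x, β s)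
    (V := fun x => M * x) (J := fun x => ∫ s in a..x, β s * f s) hab
    (fun u _ v _ huv => mul_le_mul_of_nonneg_left huv hM0) ?_
  · simpa using key
  intro ε hε
  obtain ⟨d, hd, hmod⟩ := exists_modulus hf hε
  refine ⟨d, hd, fun u v c hu hv huc hcv hvu => ?_⟩
  have huv := huc.trans hcv
  have hc : c ∈ Set.Icc a b := ⟨hu.1.trans huc, hcv.trans hv.2⟩
  rw [intervalIntegral.integral_interval_sub_left (hint hβ a haI v hv) (hint hβ a haI u hu),
    intervalIntegral.integral_interval_sub_left (hint hβf a haI v hv) (hint hβf a haI u hu),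
    ← intervalIntegral.integral_const_mul,
    ← intervalIntegral.integral_sub ((hint hβ u hu v hv).const_mul _) (hint hβf u hu v hv)]
  have := intervalIntegral.norm_integral_le_of_norm_le_const (a := u) (b := v)
    (f := fun s => f c * β s - β s * f s) (C := M * ε) ?_
  · rw [abs_of_nonneg (sub_nonneg.2 huv)] at this
    rw [← Real.norm_eq_abs]
    linarith
  · intro s hs
    rw [Set.uIoc_of_le huv] at hs
    have hs' : s ∈ Set.Icc a b := ⟨hu.1.trans hs.1.le, hs.2.trans hv.2⟩
    have : f c * β s - β s * f s = β s * (f c - f s) := by ring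
    rw [this, norm_mul]
    refine mul_le_mul (hM s hs') (hmod c hc s hs' ?_) (norm_nonneg _) hM0
    rw [abs_lt]; constructor <;> linarith [hs.1, hs.2]

lemma abs_primitive_sub_le {a b : ℝ} (hab : a ≤ b) {β : ℝ → ℝ}
    (hβ : ContinuousOn β (Set.Icc a b)) : ∃ M, 0 ≤ M ∧ ∀ u ∈ Set.Icc a b, ∀ v ∈ Set.Icc a b,
      u ≤ v → |(∫ s in a..v, β s) - ∫ s in a..u, β s| ≤ M * v - M * u := by
  obtain ⟨M, hM⟩ := isCompact_Icc.exists_bound_of_continuousOn hβ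
  have haI : a ∈ Set.Icc a b := ⟨le_rfl, hab⟩
  have hint : ∀ u ∈ Set.Icc a b, ∀ v ∈ Set.Icc a b,
      IntervalIntegrable β MeasureTheory.volume u v :=
    fun u hu v hv => (hβ.mono (Set.uIcc_subset_Icc hu hv)).intervalIntegrable
  refine ⟨M, (norm_nonneg _).trans (hM a haI), fun u hu v hv huv => ?_⟩
  rw [intervalIntegral.integral_interval_sub_left (hint a haI v hv) (hint a haI u hu)]
  have := intervalIntegral.norm_integral_le_of_norm_le_const (a := u) (b := v)
    (f := β) (C := M) fun s hs => hM s (by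
      rw [Set.uIoc_of_le huv] at hs
      exact ⟨hu.1.trans hs.1.le, hs.2.trans hv.2⟩)
  rw [abs_of_nonneg (sub_nonneg.2 huv)] at this
  rw [← Real.norm_eq_abs]
  linarith

/-! ### The right-hand sides -/

lemma nbvNorm_zero {n : ℕ} (h : ℝ) : nbvNorm h (0 : ℝ → Matrix (Fin n) (Fin n) ℝ) = 0 := by
  have : ∀ s : Set ℝ, eVariationOn (fun _ : ℝ => (0 : ℝ)) s = 0 := fun s =>
    eVariationOn.constant_on (by rintro _ ⟨_, _, rfl⟩ _ ⟨_, _, rfl⟩; rfl)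
  simp [nbvNorm, this]

lemma isNBV_zero {n : ℕ} (h : ℝ) : IsNBV h (0 : ℝ → Matrix (Fin n) (Fin n) ℝ) := by
  have : ∀ s : Set ℝ, eVariationOn (fun _ : ℝ => (0 : ℝ)) s = 0 := fun s =>
    eVariationOn.constant_on (by rintro _ ⟨_, _, rfl⟩ _ ⟨_, _, rfl⟩; rfl)
  refine fun i j => ⟨?_, rfl, fun θ _ => continuousWithinAt_const⟩
  simp [BoundedVariationOn, this]

namespace DelayData

variable {n m : ℕ}

lemma rhs_apply {h : ℝ} (hh : 0 < h) (r : Fin m → ℝ) {D : DelayData n m} (hD : D.IsContinuous h)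
    {y : ℝ → Fin n → ℝ} (hy : ContinuousOn y (Set.Icc (-h) 0)) (i : Fin n) :
    D.rhs h r y i = ∑ j, (D.A0 i j * y 0 j + ∑ l, D.A l i j * y (-r l) j +
      ∫ θ in (-h)..0, D.B θ i j * y θ j) := by
  have hle : -h ≤ 0 := by linarith
  have hyj : ∀ j, ContinuousOn (fun θ => y θ j) (Set.Icc (-h) 0) := continuousOn_pi.1 hy
  have hprod : ∀ i j, ContinuousOn (fun θ => D.B θ i j * y θ j) (Set.Icc (-h) 0) :=
    fun i j => (hD i j).mul (hyj j)
  have hvec : ContinuousOn (fun θ => (D.B θ).mulVec (y θ)) (Set.Icc (-h) 0) := by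
    refine continuousOn_pi.2 fun i => ?_
    simp only [Matrix.mulVec, dotProduct]
    exact continuousOn_finsetSum _ fun j _ => hprod i j
  have hint : (∫ θ in (-h)..0, (D.B θ).mulVec (y θ)) i =
      ∑ j, ∫ θ in (-h)..0, D.B θ i j * y θ j := by
    have h1 := ContinuousLinearMap.intervalIntegral_comp_comm (μ := MeasureTheory.volume)
      (ContinuousLinearMap.proj (R := ℝ) (φ := fun _ : Fin n => ℝ) i)
      (hvec.intervalIntegrable_of_Icc hle)
    rw [← intervalIntegral.integral_finsetSum
      fun j _ => (hprod i j).intervalIntegrable_of_Icc hle]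
    exact h1.symm
  rw [rhs, Pi.add_apply, Pi.add_apply, hint, Finset.sum_add_distrib, Finset.sum_add_distrib,
    Finset.sum_apply, Finset.sum_comm]
  rfl

lemma kernel_apply (h : ℝ) (r : Fin m → ℝ) (D : DelayData n m) (θ : ℝ) (i j : Fin n) :
    D.kernel h r θ i j = ∑ l, delayStep (r l) θ * D.A l i j + ∫ s in (-h)..θ, D.B s i j := by
  simp only [kernel, delayStep, Matrix.add_apply, Matrix.sum_apply, Matrix.smul_apply, smul_eq_mul,
    Matrix.of_apply]

lemma isRSIntegral_kernel {h : ℝ} (hh : 0 < h) {r : Fin m → ℝ} (hr : ∀ i, 0 ≤ r i ∧ r i ≤ h)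
    {D : DelayData n m} (hD : D.IsContinuous h) {f : ℝ → ℝ}
    (hf : ContinuousOn f (Set.Icc (-h) 0)) (i j : Fin n) :
    IsRSIntegral (-h) 0 (fun θ => D.kernel h r θ i j) f
      (∑ l, D.A l i j * f (-r l) + ∫ θ in (-h)..0, D.B θ i j * f θ) := by
  simp only [kernel_apply]
  exact (IsRSIntegral.sum _ fun l _ => (isRSIntegral_delayStep hh (hr l) hf).mul_const _).add
    (isRSIntegral_primitive (by linarith) (hD i j) hf)

lemma boundedVariationOn_kernel {h : ℝ} (hh : 0 < h) (r : Fin m → ℝ)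
    {D : DelayData n m} (hD : D.IsContinuous h) (i j : Fin n) :
    BoundedVariationOn (fun θ => D.kernel h r θ i j) (Set.Icc (-h) 0) := by
  obtain ⟨M, hM0, hM⟩ := abs_primitive_sub_le (by linarith : -h ≤ 0) (hD i j)
  have hstep : ∀ l, ∀ u ∈ Set.Icc (-h) 0, ∀ v ∈ Set.Icc (-h) 0, u ≤ v →
      delayStep (r l) u ≤ delayStep (r l) v := fun l u hu v hv huv =>
    delayStep_monotoneOn hu hv huv
  refine boundedVariationOn_of_abs_sub_le
    (V := fun θ => ∑ l, delayStep (r l) θ * |D.A l i j| + M * θ) (by linarith) ?_ ?_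
  · intro u hu v hv huv
    exact add_le_add (Finset.sum_le_sum fun l _ =>
      mul_le_mul_of_nonneg_right (hstep l u hu v hv huv) (abs_nonneg _))
      (mul_le_mul_of_nonneg_left huv hM0)
  · intro u hu v hv huv
    simp only [kernel_apply]
    have h1 : |∑ l, delayStep (r l) v * D.A l i j - ∑ l, delayStep (r l) u * D.A l i j| ≤
        ∑ l, delayStep (r l) v * |D.A l i j| - ∑ l, delayStep (r l) u * |D.A l i j| := by
      rw [← Finset.sum_sub_distrib, ← Finset.sum_sub_distrib]
      refine (Finset.abs_sum_le_sum_abs _ _).trans (Finset.sum_le_sum fun l _ => ?_)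
      rw [← sub_mul, ← sub_mul, abs_mul, abs_of_nonneg (sub_nonneg.2 (hstep l u hu v hv huv))]
    rw [add_sub_add_comm, add_sub_add_comm]
    exact (abs_add_le _ _).trans (add_le_add h1 (hM u hu v hv huv))

/-- Splits the perturbation off the nominal right-hand side. Bounded variation of `δ` guarantees
that its integral exists, so that `rsIntegral` is additive here and not a default value. -/
lemma stieltjesRhs_kernel_add_apply {h : ℝ} (hh : 0 < h) {r : Fin m → ℝ}
    (hr : ∀ i, 0 ≤ r i ∧ r i ≤ h) {D : DelayData n m} (hD : D.IsContinuous h)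
    {Δ : Matrix (Fin n) (Fin n) ℝ} {δ : ℝ → Matrix (Fin n) (Fin n) ℝ}
    (hδ : ∀ i j, BoundedVariationOn (fun θ => δ θ i j) (Set.Icc (-h) 0))
    {y : ℝ → Fin n → ℝ} (hy : ContinuousOn y (Set.Icc (-h) 0)) (i : Fin n) :
    stieltjesRhs h (D.A0 + Δ) (D.kernel h r + δ) y i = D.rhs h r y i +
      (Δ.mulVec (y 0) i + ∑ j, rsIntegral (-h) 0 (fun θ => δ θ i j) (fun θ => y θ j)) := by
  have hle : -h ≤ 0 := by linarith
  have hyj : ∀ j, ContinuousOn (fun θ => y θ j) (Set.Icc (-h) 0) := continuousOn_pi.1 hy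
  have hadd : ∀ j, rsIntegral (-h) 0 (fun θ => (D.kernel h r + δ) θ i j) (fun θ => y θ j) =
      (∑ l, D.A l i j * y (-r l) j + ∫ θ in (-h)..0, D.B θ i j * y θ j) +
        rsIntegral (-h) 0 (fun θ => δ θ i j) (fun θ => y θ j) := by
    intro j
    obtain ⟨I, hI⟩ := exists_isRSIntegral hle (hδ i j) (hyj j)
    rw [hI.rsIntegral_eq hle]
    exact ((isRSIntegral_kernel hh hr hD (hyj j) i j).add hI).rsIntegral_eq hle
  rw [rhs_apply hh r hD hy, stieltjesRhs, Pi.add_apply, Matrix.add_mulVec, Pi.add_apply]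
  simp only [hadd, Finset.sum_add_distrib]
  simp only [Matrix.mulVec, dotProduct]
  ring

lemma IsContinuous.perturb {h : ℝ} {D P : DelayData n m} (hD : D.IsContinuous h)
    (hP : P.IsContinuous h) : (D.perturb P).IsContinuous h :=
  fun i j => (hD i j).add (hP i j)

/-- Makes coefficient perturbations a special case of Stieltjes perturbations, so one robustness
estimate serves both radii. -/
lemma rhs_perturb {h : ℝ} (hh : 0 < h) {r : Fin m → ℝ}
    (hr : ∀ i, 0 ≤ r i ∧ r i ≤ h) {D P : DelayData n m} (hD : D.IsContinuous h)
    (hP : P.IsContinuous h) {y : ℝ → Fin n → ℝ} (hy : ContinuousOn y (Set.Icc (-h) 0)) :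
    (D.perturb P).rhs h r y = stieltjesRhs h (D.A0 + P.A0) (D.kernel h r + P.kernel h r) y := by
  have hle : -h ≤ 0 := by linarith
  have hyj : ∀ j, ContinuousOn (fun θ => y θ j) (Set.Icc (-h) 0) := continuousOn_pi.1 hy
  ext i
  rw [stieltjesRhs_kernel_add_apply hh hr hD (fun i j => boundedVariationOn_kernel hh r hP i j) hy,
    rhs_apply hh r hD hy, rhs_apply hh r (hD.perturb hP) hy]
  simp only [(isRSIntegral_kernel hh hr hP (hyj _) i _).rsIntegral_eq hle, Matrix.mulVec,
    dotProduct, ← Finset.sum_add_distrib]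
  refine Finset.sum_congr rfl fun j _ => ?_
  have hB : ∫ θ in (-h)..0, (D.perturb P).B θ i j * y θ j =
      (∫ θ in (-h)..0, D.B θ i j * y θ j) + ∫ θ in (-h)..0, P.B θ i j * y θ j := by
    refine Eq.trans (intervalIntegral.integral_congr fun θ _ => add_mul _ _ _)
      (intervalIntegral.integral_add
        (((hD i j).mul (hyj j)).intervalIntegrable_of_Icc hle)
        (((hP i j).mul (hyj j)).intervalIntegrable_of_Icc hle))
  rw [hB]
  simp only [DelayData.perturb, Matrix.add_apply, Pi.add_apply, add_mul, Finset.sum_add_distrib]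
  ring

/-- The matrix `A⁰ + ∑ᵢ e^{-λ rᵢ} Aⁱ + ∫_{-h}^0 e^{λ θ} B(θ) dθ`, by which the right-hand side acts
on `e^{λ θ} v`. -/
def symbol (h : ℝ) (r : Fin m → ℝ) (D : DelayData n m) (lam : ℝ) : Matrix (Fin n) (Fin n) ℝ :=
  Matrix.of fun i j => D.A0 i j + ∑ l, D.A l i j * Real.exp (lam * -r l) +
    ∫ θ in (-h)..0, D.B θ i j * Real.exp (lam * θ)

lemma symbol_zero (h : ℝ) (r : Fin m → ℝ) (D : DelayData n m) : D.symbol h r 0 = D.H h := by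
  ext i j
  simp [symbol, H, Matrix.sum_apply]

lemma continuousOn_exp_smul (c lam : ℝ) (v : Fin n → ℝ) (s : Set ℝ) :
    ContinuousOn (fun θ => (c * Real.exp (lam * θ)) • v) s := by
  fun_prop

lemma rhs_exp_smul {h : ℝ} (hh : 0 < h) (r : Fin m → ℝ) {D : DelayData n m}
    (hD : D.IsContinuous h) (c lam : ℝ) (v : Fin n → ℝ) :
    D.rhs h r (fun θ => (c * Real.exp (lam * θ)) • v) = c • (D.symbol h r lam).mulVec v := by
  ext i
  rw [rhs_apply hh r hD (continuousOn_exp_smul c lam v _)]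
  simp only [Pi.smul_apply, smul_eq_mul, Matrix.mulVec, dotProduct, symbol, Matrix.of_apply,
    Finset.mul_sum, mul_zero, Real.exp_zero, mul_one]
  refine Finset.sum_congr rfl fun j _ => ?_
  have e1 : ∫ θ in (-h)..0, D.B θ i j * (c * Real.exp (lam * θ) * v j) =
      (∫ θ in (-h)..0, D.B θ i j * Real.exp (lam * θ)) * (c * v j) := by
    rw [← intervalIntegral.integral_mul_const]
    exact intervalIntegral.integral_congr fun θ _ => by ring
  have e2 : ∑ l, D.A l i j * (c * Real.exp (lam * -r l) * v j) =
      (∑ l, D.A l i j * Real.exp (lam * -r l)) * (c * v j) := by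
    rw [Finset.sum_mul]
    exact Finset.sum_congr rfl fun l _ => by ring
  rw [e1, e2]
  ring

lemma continuous_symbol {h : ℝ} (hh : 0 < h) (r : Fin m → ℝ) {D : DelayData n m}
    (hD : D.IsContinuous h) : Continuous (D.symbol h r) := by
  refine continuous_matrix fun i j => ?_
  simp only [symbol, Matrix.of_apply]
  refine (continuous_const.add (by fun_prop)).add ?_
  have hle : -h ≤ 0 := by linarith
  -- `B` is continuous only on `[-h, 0]`; continuity of the parametric integral is applied to a
  -- continuous extension.
  let β : ℝ → ℝ := Set.IccExtend hle ((Set.Icc (-h) 0).domRestrict fun θ => D.B θ i j)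
  have hβ : Continuous β :=
    (continuousOn_iff_continuous_domRestrict.1 (hD i j)).Icc_extend'
  have e : (fun lam => ∫ θ in (-h)..0, D.B θ i j * Real.exp (lam * θ)) =
      fun lam => ∫ θ in (-h)..0, β θ * Real.exp (lam * θ) := by
    ext lam
    refine intervalIntegral.integral_congr fun θ hθ => ?_
    rw [Set.uIcc_of_le hle] at hθ
    simp only [β, Set.IccExtend_of_mem hle _ hθ, Set.domRestrict_apply]
  rw [e]
  exact intervalIntegral.continuous_parametric_intervalIntegral_of_continuous'
    (by unfold Function.uncurry; fun_prop) _ _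

lemma IsDominatedBy.refl_right {h : ℝ} {D D' : DelayData n m} (hd : D.IsDominatedBy h D') :
    D'.IsDominatedBy h D' where
  metzler a b hab := (hd.metzler a b hab).trans (hd.A0_le a b)
  A0_le _ _ := le_rfl
  A_nonneg l a b := (hd.A_nonneg l a b).trans (hd.A_le l a b)
  A_le _ _ _ := le_rfl
  B_nonneg θ hθ a b := (hd.B_nonneg θ hθ a b).trans (hd.B_le θ hθ a b)
  B_le _ _ _ _ := le_rfl

/-- Comparison of right-hand sides: if `|y| ≤ z` with `± y_i(0) = z_i(0)`, then the `i`-th entry of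
the right-hand side at `± y` is at most that of the dominating system at `z`. -/
lemma IsDominatedBy.rhs_le {h : ℝ} (hh : 0 < h) {r : Fin m → ℝ}
    (hr : ∀ i, 0 ≤ r i ∧ r i ≤ h) {D D' : DelayData n m} (hD : D.IsContinuous h)
    (hD' : D'.IsContinuous h) (hd : D.IsDominatedBy h D') {y z : ℝ → Fin n → ℝ}
    (hy : ContinuousOn y (Set.Icc (-h) 0)) (hz : ContinuousOn z (Set.Icc (-h) 0))
    (hyz : ∀ θ ∈ Set.Icc (-h) 0, ∀ j, |y θ j| ≤ z θ j) {s : ℝ} (hs : |s| = 1) {i : Fin n}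
    (hi : s * y 0 i = z 0 i) : s * D.rhs h r y i ≤ D'.rhs h r z i := by
  have hle : -h ≤ 0 := by linarith
  have hyj : ∀ j, ContinuousOn (fun θ => y θ j) (Set.Icc (-h) 0) := continuousOn_pi.1 hy
  have hzj : ∀ j, ContinuousOn (fun θ => z θ j) (Set.Icc (-h) 0) := continuousOn_pi.1 hz
  have h0 : (0 : ℝ) ∈ Set.Icc (-h) 0 := ⟨hle, le_rfl⟩
  have hz0 : ∀ θ ∈ Set.Icc (-h) 0, ∀ j, 0 ≤ z θ j := fun θ hθ j =>
    (abs_nonneg _).trans (hyz θ hθ j)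
  have hsy : ∀ θ ∈ Set.Icc (-h) 0, ∀ j, s * y θ j ≤ z θ j := fun θ hθ j => by
    refine (le_abs_self _).trans ?_
    rw [abs_mul, hs, one_mul]; exact hyz θ hθ j
  rw [rhs_apply hh r hD hy, rhs_apply hh r hD' hz, Finset.mul_sum]
  refine Finset.sum_le_sum fun j _ => ?_
  have key : ∀ θ ∈ Set.Icc (-h) 0, ∀ a b : ℝ, 0 ≤ a → a ≤ b → s * (a * y θ j) ≤ b * z θ j := by
    intro θ hθ a b ha hab
    calc s * (a * y θ j) = a * (s * y θ j) := by ring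
      _ ≤ a * z θ j := mul_le_mul_of_nonneg_left (hsy θ hθ j) ha
      _ ≤ b * z θ j := mul_le_mul_of_nonneg_right hab (hz0 θ hθ j)
  rw [mul_add, mul_add]
  refine add_le_add (add_le_add ?_ ?_) ?_
  -- The diagonal entry may be negative, so an inequality for `y_i(0)` would not do; this is where
  -- `s * y 0 i = z 0 i` enters.
  · by_cases hij : i = j
    · subst hij
      calc s * (D.A0 i i * y 0 i) = D.A0 i i * (s * y 0 i) := by ring
        _ ≤ _ := by rw [hi]; exact mul_le_mul_of_nonneg_right (hd.A0_le i i) (hz0 0 h0 i)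
    · exact key 0 h0 _ _ (hd.metzler i j hij) (hd.A0_le i j)
  · rw [Finset.mul_sum]
    exact Finset.sum_le_sum fun l _ => key _ ⟨by linarith [(hr l).2], by linarith [(hr l).1]⟩ _ _
      (hd.A_nonneg l i j) (hd.A_le l i j)
  · rw [← intervalIntegral.integral_const_mul]
    exact intervalIntegral.integral_mono_on hle
      ((((hD i j).mul (hyj j)).intervalIntegrable_of_Icc hle).const_mul s)
      (((hD' i j).mul (hzj j)).intervalIntegrable_of_Icc hle)
      fun θ hθ => key θ hθ _ _ (hd.B_nonneg θ hθ i j) (hd.B_le θ hθ i j)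

end DelayData

/-! ### Inverses of Z-matrices -/

section ZMatrix

variable {n : ℕ} {Z : Matrix (Fin n) (Fin n) ℝ}

/-- Minimum principle: let `k` minimise `x_i / p_i`, with value `c`. Then `x ≥ c p` with equality at
`k`, and the sign of the off-diagonal entries gives `(Z x)_k ≤ c (Z p)_k`, which is negative if `c <
0`. -/
lemma nonneg_of_zMatrix_mulVec_nonneg (hZ : ∀ i j, i ≠ j → Z i j ≤ 0) {p : Fin n → ℝ}
    (hp : ∀ i, 0 < p i) (hZp : ∀ i, 0 < Z.mulVec p i) {x : Fin n → ℝ}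
    (hx : ∀ i, 0 ≤ Z.mulVec x i) (i : Fin n) : 0 ≤ x i := by
  obtain ⟨k, -, hk⟩ := Finset.exists_min_image Finset.univ (fun i => x i / p i) ⟨i, Finset.mem_univ i⟩
  by_contra! hi
  have hc : x k / p k < 0 := (hk i (Finset.mem_univ i)).trans_lt (div_neg_of_neg_of_pos hi (hp i))
  have hle : ∀ j, x k / p k * p j ≤ x j := fun j => by
    rw [← le_div_iff₀ (hp j)]; exact hk j (Finset.mem_univ j)
  have h1 : Z.mulVec x k ≤ x k / p k * Z.mulVec p k := by
    simp only [Matrix.mulVec, dotProduct, Finset.mul_sum]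
    refine Finset.sum_le_sum fun j _ => ?_
    by_cases hkj : k = j
    · subst hkj
      refine le_of_eq ?_
      field_simp [(hp k).ne']
    · nlinarith [hZ k j hkj, hle j]
  exact absurd (hx k) (not_le.2 (h1.trans_lt (mul_neg_of_neg_of_pos hc (hZp k))))

lemma det_ne_zero_of_zMatrix (hZ : ∀ i j, i ≠ j → Z i j ≤ 0) {p : Fin n → ℝ}
    (hp : ∀ i, 0 < p i) (hZp : ∀ i, 0 < Z.mulVec p i) : Z.det ≠ 0 := by
  intro h0
  obtain ⟨v, hv, hZv⟩ := Matrix.exists_mulVec_eq_zero_iff.2 h0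
  refine hv (funext fun i => le_antisymm ?_ ?_)
  · have := nonneg_of_zMatrix_mulVec_nonneg hZ hp hZp (x := -v)
      (by intro i; simp [Matrix.mulVec_neg, hZv]) i
    simpa using this
  · exact nonneg_of_zMatrix_mulVec_nonneg hZ hp hZp (by intro i; simp [hZv]) i

lemma inv_nonneg_of_zMatrix (hZ : ∀ i j, i ≠ j → Z i j ≤ 0) {p : Fin n → ℝ}
    (hp : ∀ i, 0 < p i) (hZp : ∀ i, 0 < Z.mulVec p i) (i j : Fin n) : 0 ≤ Z⁻¹ i j := by
  have hdet := isUnit_iff_ne_zero.2 (det_ne_zero_of_zMatrix hZ hp hZp)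
  have h := nonneg_of_zMatrix_mulVec_nonneg hZ hp hZp (x := Z⁻¹.mulVec (Pi.single j 1)) (by
    intro k
    rw [Matrix.mulVec_mulVec, Matrix.mul_nonsing_inv _ hdet, Matrix.one_mulVec]
    by_cases hkj : k = j
    · subst hkj; simp
    · simp [hkj]) i
  simpa using h

/-- If the `i`-th entry of `q = Z⁻¹ 1 ≥ 0` vanished, only nonpositive off-diagonal terms would
remain in `(Z q)_i = 1`. -/
lemma inv_mulVec_one_pos (hZ : ∀ i j, i ≠ j → Z i j ≤ 0) (hdet : Z.det ≠ 0)
    (hinv : ∀ i j, 0 ≤ Z⁻¹ i j) (i : Fin n) : 0 < Z⁻¹.mulVec 1 i := by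
  have h0 : ∀ j, 0 ≤ Z⁻¹.mulVec 1 j := fun j => by
    simp only [Matrix.mulVec, dotProduct, Pi.one_apply, mul_one]
    exact Finset.sum_nonneg fun k _ => hinv j k
  refine (h0 i).lt_of_ne fun hi => ?_
  have h1 : Z.mulVec (Z⁻¹.mulVec 1) i = 1 := by
    rw [Matrix.mulVec_mulVec, Matrix.mul_nonsing_inv _ (isUnit_iff_ne_zero.2 hdet),
      Matrix.one_mulVec, Pi.one_apply]
  have h2 : Z.mulVec (Z⁻¹.mulVec 1) i ≤ 0 := by
    rw [Matrix.mulVec, dotProduct]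
    refine Finset.sum_nonpos fun j _ => ?_
    by_cases hij : i = j
    · subst hij; rw [← hi, mul_zero]
    · exact mul_nonpos_of_nonpos_of_nonneg (hZ i j hij) (h0 j)
  linarith

lemma norm_eq_norm_mulVec_one {A : Matrix (Fin n) (Fin n) ℝ} (hA : ∀ i j, 0 ≤ A i j) :
    ‖A‖ = ‖A.mulVec 1‖ := by
  rw [Matrix.linfty_opNorm_def, Pi.norm_def]
  congr 1
  refine Finset.sup_congr rfl fun i _ => ?_
  ext
  have : 0 ≤ ∑ j, A i j := Finset.sum_nonneg fun j _ => hA i j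
  simp [Matrix.mulVec, dotProduct, abs_of_nonneg, hA, this]

/-- A continuous path of nonsingular Z-matrices on `[0, Λ]` keeps nonnegative inverses. -/
lemma inv_nonneg_of_path {W : ℝ → Matrix (Fin n) (Fin n) ℝ} (hW : Continuous W) {Λ : ℝ}
    (hΛ : 0 ≤ Λ) (hZ : ∀ t ∈ Set.Icc 0 Λ, ∀ i j, i ≠ j → W t i j ≤ 0)
    (hdet : ∀ t ∈ Set.Icc 0 Λ, (W t).det ≠ 0) {p : Fin n → ℝ} (hp : ∀ i, 0 < p i)
    (hWp : ∀ i, 0 < (W 0).mulVec p i) (i j : Fin n) : 0 ≤ (W Λ)⁻¹ i j := by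
  suffices h : Set.Icc 0 Λ ⊆ {t | ∀ i j, 0 ≤ (W t)⁻¹ i j} from h ⟨hΛ, le_rfl⟩ i j
  apply IsClosed.Icc_subset_of_forall_exists_gt
  · have hc : ContinuousOn (fun t => (W t)⁻¹) (Set.Icc 0 Λ) := by
      simp only [Matrix.inv_def, Ring.inverse_eq_inv']
      exact (hW.matrix_det.continuousOn.inv₀ hdet).smul hW.matrix_adjugate.continuousOn
    have hcl : IsClosed {A : Matrix (Fin n) (Fin n) ℝ | ∀ i j, 0 ≤ A i j} := by
      simp only [Set.ofPred_forall]
      exact isClosed_iInter fun i => isClosed_iInter fun j =>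
        isClosed_le continuous_const (continuous_id.matrix_elem i j)
    have := hc.preimage_isClosed_of_isClosed isClosed_Icc hcl
    rwa [Set.inter_comm] at this
  · exact inv_nonneg_of_zMatrix (hZ 0 ⟨le_rfl, hΛ⟩) hp hWp
  · rintro t ⟨ht, htI⟩ y hy
    have htI' : t ∈ Set.Icc 0 Λ := ⟨htI.1, htI.2.le⟩
    -- Openness to the right: `q = W(t)⁻¹ 1 > 0` satisfies `W(t) q = 1`, so `W(u) q > 0` for `u`
    -- near `t`, and `q` certifies `W(u)⁻¹ ≥ 0`.
    have hq := inv_mulVec_one_pos (hZ t htI') (hdet t htI') ht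
    set q := (W t)⁻¹.mulVec 1 with hqdef
    have hWq : ∀ i, (W t).mulVec q i = 1 := fun i => by
      rw [hqdef, Matrix.mulVec_mulVec, Matrix.mul_nonsing_inv _ (isUnit_iff_ne_zero.2 (hdet t htI')),
        Matrix.one_mulVec, Pi.one_apply]
    have hev : ∀ᶠ u in nhds t, ∀ i, 0 < (W u).mulVec q i := by
      refine Filter.eventually_all.2 fun i => ?_
      have hcont : Continuous fun u => (W u).mulVec q i :=
        (continuous_apply i).comp (hW.matrix_mulVec continuous_const)
      exact hcont.continuousAt.eventually_const_lt (one_pos.trans_eq (hWq i).symm)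
    have hev' : ∀ᶠ u in nhdsWithin t (Set.Ioi t), (∀ i, 0 < (W u).mulVec q i) ∧
        u ∈ Set.Ioc t (min y Λ) :=
      (hev.filter_mono nhdsWithin_le_nhds).and (Ioc_mem_nhdsGT (lt_min hy htI.2))
    obtain ⟨u, hu, huI⟩ := hev'.exists
    exact ⟨u, inv_nonneg_of_zMatrix
      (hZ u ⟨htI.1.trans huI.1.le, huI.2.trans (min_le_right _ _)⟩) hq hu,
      huI.1, huI.2.trans (min_le_left _ _)⟩

end ZMatrix

/-! ### The decay estimate -/

lemma eventually_neg_of_hasDerivWithinAt {f : ℝ → ℝ} {f' t : ℝ}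
    (hf : HasDerivWithinAt f f' (Set.Ici t) t) (h0 : f t = 0) (hf' : f' < 0) :
    ∀ᶠ s in nhdsWithin t (Set.Ioi t), f s < 0 := by
  have h1 := (hasDerivWithinAt_iff_tendsto_slope' (Set.self_notMem_Ioi)).1 hf.Ioi_of_Ici
  filter_upwards [h1.eventually_lt_const hf', self_mem_nhdsWithin] with s hs hst
  rw [slope_def_field, h0, sub_zero] at hs
  have : 0 < s - t := sub_pos.2 hst
  by_contra! hneg
  exact absurd hs (not_lt.2 (div_nonneg hneg this.le))

/-- If the vector field points strictly inward on the boundary of the shrinking boxes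
`|x_i| ≤ C e^{-αt} p_i`, then all solutions decay exponentially. -/
lemma hasDecay_of_inward {n : ℕ} {h : ℝ} (hh : 0 < h) {p : Fin n → ℝ} (hp : ∀ i, 0 < p i)
    {q : ℝ} (hq : ∀ i, 1 ≤ q * p i) (hq0 : 0 ≤ q) {α : ℝ} (hα : 0 < α)
    {G : ℝ → (ℝ → Fin n → ℝ) → (Fin n → ℝ)}
    (hG : ∀ t, 0 ≤ t → ∀ y : ℝ → Fin n → ℝ, ContinuousOn y (Set.Icc (-h) 0) → ∀ C > 0,
      (∀ θ ∈ Set.Icc (-h) 0, ∀ j, |y θ j| ≤ C * Real.exp (-α * θ) * p j) →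
      ∀ s : ℝ, |s| = 1 → ∀ i, s * y 0 i = C * p i → s * G t y i < -α * (C * p i)) :
    HasDecay h G (q * ‖p‖) α := by
  intro φ x hx
  -- The strict inequality ensures `C > 0` even for `φ = 0`; afterwards `C` decreases to `q * ‖φ‖`.
  have main : ∀ C > q * ‖φ‖, ∀ t, 0 ≤ t → ∀ i, |x t i| ≤ C * Real.exp (-α * t) * p i := by
    intro C hC T hT
    have hC0 : 0 < C := lt_of_le_of_lt (mul_nonneg hq0 (norm_nonneg _)) hC
    have hpast : ∀ u ∈ Set.Icc (-h) 0, ∀ i, |x u i| ≤ C * Real.exp (-α * u) * p i := by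
      intro u hu i
      have h1 : |x u i| ≤ ‖φ‖ := by
        have e := hx.initial ⟨u, hu⟩
        rw [show x u = φ ⟨u, hu⟩ from e, ← Real.norm_eq_abs]
        exact (norm_le_pi_norm _ i).trans (φ.norm_coe_le_norm _)
      have h2 : 1 ≤ Real.exp (-α * u) := Real.one_le_exp (by nlinarith [hu.2])
      calc |x u i| ≤ ‖φ‖ * 1 := by rw [mul_one]; exact h1
        _ ≤ ‖φ‖ * (q * p i) := mul_le_mul_of_nonneg_left (hq i) (norm_nonneg _)
        _ = q * ‖φ‖ * p i * 1 := by ring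
        _ ≤ C * p i * Real.exp (-α * u) := mul_le_mul
            (mul_le_mul_of_nonneg_right hC.le (hp i).le) h2 zero_le_one
            (mul_nonneg hC0.le (hp i).le)
        _ = _ := by ring
    -- Clamping by `min u t` encodes the bound on all of `[0, t]`, needed for the history, as a
    -- condition closed in `t` for each fixed `u`.
    let S : Set ℝ := {t | ∀ u ∈ Set.Icc 0 T, ∀ i,
      |x (min u t) i| ≤ C * Real.exp (-α * min u t) * p i}
    have hcx : ContinuousOn x (Set.Ici 0) := hx.continuousOn.mono (Set.Ici_subset_Ici.2 (by linarith))
    have hsub : Set.Icc 0 T ⊆ S := by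
      apply IsClosed.Icc_subset_of_forall_exists_gt
      · have : S ∩ Set.Icc 0 T = Set.Icc 0 T ∩ ⋂ u : Set.Icc 0 T, ⋂ i : Fin n,
            {t | t ∈ Set.Icc 0 T ∧ |x (min u t) i| ≤ C * Real.exp (-α * min (u : ℝ) t) * p i} := by
          ext t
          simp only [S, Set.mem_inter_iff, Set.mem_ofPred_eq, Set.mem_iInter, Subtype.forall]
          constructor
          · exact fun ⟨h1, h2⟩ => ⟨h2, fun u hu i => ⟨h2, h1 u hu i⟩⟩
          · exact fun ⟨h1, h2⟩ => ⟨fun u hu i => (h2 u hu i).2, h1⟩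
        rw [this]
        refine isClosed_Icc.inter (isClosed_iInter fun u => isClosed_iInter fun i => ?_)
        refine isClosed_Icc.isClosed_le (f := fun t => |x (min u t) i|)
          (g := fun t => C * Real.exp (-α * min (u : ℝ) t) * p i) ?_ (by fun_prop)
        have hmin : ContinuousOn (fun t : ℝ => x (min (u : ℝ) t)) (Set.Icc 0 T) :=
          hcx.comp (by fun_prop) fun t ht => le_min u.2.1 ht.1
        exact (continuousOn_pi.1 hmin i).abs
      · intro u hu i
        rw [min_eq_right hu.1]
        exact hpast 0 ⟨by linarith, le_rfl⟩ i
      · rintro t ⟨ht, htI⟩ y hy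
        have hhist : ∀ u ∈ Set.Icc (-h) t, ∀ i, |x u i| ≤ C * Real.exp (-α * u) * p i := by
          intro u hu i
          rcases le_total u 0 with h0 | h0
          · exact hpast u ⟨hu.1, h0⟩ i
          · have := ht u ⟨h0, hu.2.trans htI.2.le⟩ i
            rwa [min_eq_left hu.2] at this
        have hderiv := hx.hasDeriv t htI.1
        have hcont : ContinuousWithinAt x (Set.Ioi t) t :=
          hderiv.continuousWithinAt.mono Set.Ioi_subset_Ici_self
        have hside : ∀ s : ℝ, |s| = 1 → ∀ i, ∀ᶠ u in nhdsWithin t (Set.Ioi t),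
            s * x u i ≤ C * Real.exp (-α * u) * p i := by
          intro s hs i
          have hle : s * x t i ≤ C * Real.exp (-α * t) * p i := by
            refine (le_abs_self _).trans ?_
            rw [abs_mul, hs, one_mul]
            exact hhist t ⟨by linarith [htI.1], le_rfl⟩ i
          -- Off the face continuity suffices; on the face the difference has negative right
          -- derivative.
          rcases hle.lt_or_eq with hlt | heq
          · have hc1 : ContinuousWithinAt (fun u => s * x u i) (Set.Ioi t) t :=
              continuousWithinAt_const.mul (continuousWithinAt_pi.1 hcont i)
            have hc2 : ContinuousWithinAt (fun u => C * Real.exp (-α * u) * p i) (Set.Ioi t) t := by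
              fun_prop
            exact (hc1.eventually_lt hc2 hlt).mono fun _ h => h.le
          · have hineq := hG t htI.1 (fun θ => x (t + θ))
              (hx.continuousOn.comp (by fun_prop) fun θ hθ => by
                simp only [Set.mem_Ici]; linarith [hθ.1, htI.1])
              (C * Real.exp (-α * t)) (mul_pos hC0 (Real.exp_pos _))
              (fun θ hθ j => by
                have := hhist (t + θ) ⟨by linarith [hθ.1, htI.1], by linarith [hθ.2]⟩ j
                rwa [mul_add, Real.exp_add, ← mul_assoc] at this)
              s hs i (by simpa using heq)
            have hd1 : HasDerivWithinAt (fun u => s * x u i - C * Real.exp (-α * u) * p i)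
                (s * G t (fun θ => x (t + θ)) i - C * (Real.exp (-α * t) * (-α * 1)) * p i)
                (Set.Ici t) t :=
              ((hasDerivWithinAt_pi.1 hderiv i).const_mul s).sub
                (((((hasDerivAt_id t).const_mul (-α)).exp).const_mul C).mul_const
                  (p i)).hasDerivWithinAt
            have := eventually_neg_of_hasDerivWithinAt hd1 (by simp [heq]) (by linarith)
            exact this.mono fun u hu => by linarith
        have hev : ∀ᶠ u in nhdsWithin t (Set.Ioi t), ∀ i,
            |x u i| ≤ C * Real.exp (-α * u) * p i := by
          refine Filter.eventually_all.2 fun i => ?_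
          filter_upwards [hside 1 (by simp) i, hside (-1) (by simp) i] with u h1 h2
          rw [abs_le]; constructor <;> linarith
        obtain ⟨v, hv, hvs⟩ := mem_nhdsGT_iff_exists_Ioc_subset.1 hev
        refine ⟨min v y, ?_, lt_min hv hy, min_le_right _ _⟩
        intro u hu i
        rcases le_total (min u (min v y)) t with hle | hge
        · exact hhist _ ⟨le_trans (by linarith) (le_min hu.1
            (htI.1.trans (lt_min hv hy).le)), hle⟩ i
        · rcases hge.eq_or_lt with heq | hlt
          · rw [← heq]; exact hhist t ⟨by linarith [htI.1], le_rfl⟩ i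
          · exact hvs ⟨hlt, (min_le_right _ _).trans (min_le_left _ _)⟩ i
    intro i
    have := hsub (Set.right_mem_Icc.2 hT) T ⟨hT, le_rfl⟩ i
    rwa [min_self] at this
  intro t ht
  refine le_of_forall_pos_le_add fun ε hε => ?_
  have hE := Real.exp_pos (-α * t)
  -- The `+ 1` covers `‖p‖ = 0`, possible here when `n = 0`.
  set η := ε / (Real.exp (-α * t) * ‖p‖ + 1) with hη
  have hden : 0 < Real.exp (-α * t) * ‖p‖ + 1 := by positivity
  have hη0 : 0 < η := div_pos hε hden
  rw [pi_norm_le_iff_of_nonneg (by positivity)]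
  intro i
  have h1 := main (q * ‖φ‖ + η) (by linarith) t ht i
  have h2 : p i ≤ ‖p‖ := (le_abs_self _).trans (norm_le_pi_norm p i)
  calc ‖x t i‖ ≤ (q * ‖φ‖ + η) * Real.exp (-α * t) * p i := h1
    _ ≤ (q * ‖φ‖ + η) * Real.exp (-α * t) * ‖p‖ :=
        mul_le_mul_of_nonneg_left h2 (by positivity)
    _ = q * ‖p‖ * Real.exp (-α * t) * ‖φ‖ + η * (Real.exp (-α * t) * ‖p‖) := by ring
    _ ≤ _ := by
        have : η * (Real.exp (-α * t) * ‖p‖ + 1) = ε := by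
          rw [hη]; field_simp
        linarith

/-- Only the action of the right-hand side on continuous functions matters for stability. -/
lemma IsExpStable.congr {n : ℕ} {h : ℝ} {G G' : ℝ → (ℝ → Fin n → ℝ) → (Fin n → ℝ)}
    (hGG' : ∀ t y, ContinuousOn y (Set.Icc (-h) 0) → G t y = G' t y) (hG : IsExpStable h G) :
    IsExpStable h G' := by
  obtain ⟨M, hM, α, hα, hdec⟩ := hG
  refine ⟨M, hM, α, hα, fun φ x hx => hdec φ x ⟨hx.continuousOn, hx.initial, fun t ht => ?_⟩⟩
  rw [hGG' t (fun θ => x (t + θ)) (hx.continuousOn.comp (by fun_prop) fun θ hθ => by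
    simp only [Set.mem_Ici]; linarith [hθ.1, ht])]
  exact hx.hasDeriv t ht

/-- A real eigenvalue `lam ≥ 0` of the characteristic equation excludes exponential stability. -/
lemma DelayData.not_isExpStable_of_symbol_eigenvector {n m : ℕ} {h : ℝ} (hh : 0 < h)
    (r : Fin m → ℝ) {D : DelayData n m} (hD : D.IsContinuous h) {lam : ℝ} (hlam : 0 ≤ lam)
    {v : Fin n → ℝ} (hv : v ≠ 0) (hev : (D.symbol h r lam).mulVec v = lam • v) :
    ¬ IsExpStable h (fun _ => D.rhs h r) := by
  rintro ⟨M, hM, α, hα, hdec⟩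
  have hsol : IsSolution h (fun _ => D.rhs h r)
      ⟨fun θ => Real.exp (lam * (θ : ℝ)) • v, by fun_prop⟩ (fun t => Real.exp (lam * t) • v) := by
    refine ⟨by fun_prop, fun θ => rfl, fun t _ => ?_⟩
    have e : (fun θ => Real.exp (lam * (t + θ)) • v) =
        fun θ => (Real.exp (lam * t) * Real.exp (lam * θ)) • v := by
      ext1 θ; rw [mul_add, Real.exp_add]
    simp only [e, rhs_exp_smul hh r hD, hev]
    have := (((hasDerivAt_id t).const_mul lam).exp.smul_const v).hasDerivWithinAt (s := Set.Ici t)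
    simpa [smul_smul] using this
  set φ : C(Set.Icc (-h) 0, Fin n → ℝ) := ⟨fun θ => Real.exp (lam * (θ : ℝ)) • v, by fun_prop⟩
  have hlim : Filter.Tendsto (fun t => M * Real.exp (-α * t) * ‖φ‖) Filter.atTop (nhds 0) := by
    have h1 : Filter.Tendsto (fun t => Real.exp (-α * t)) Filter.atTop (nhds 0) :=
      Real.tendsto_exp_atBot.comp (Filter.tendsto_id.const_mul_atTop_of_neg (by linarith))
    simpa using (h1.const_mul M).mul_const ‖φ‖
  have hge : ∀ᶠ t in Filter.atTop, ‖v‖ ≤ M * Real.exp (-α * t) * ‖φ‖ := by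
    filter_upwards [Filter.eventually_ge_atTop 0] with t ht
    refine le_trans ?_ (hdec φ _ hsol t ht)
    rw [norm_smul, Real.norm_of_nonneg (Real.exp_pos _).le]
    exact le_mul_of_one_le_left (norm_nonneg _) (Real.one_le_exp (mul_nonneg hlam ht))
  exact absurd (ge_of_tendsto hlim hge) (not_le.2 (norm_pos_iff.2 hv))

/-! ### Stability and stability radii of dominated positive systems -/

variable {n m : ℕ}

lemma _root_.Matrix.norm_inv_neg (A : Matrix (Fin n) (Fin n) ℝ) (hA : A.det ≠ 0) :
    ‖(-A)⁻¹‖ = ‖A⁻¹‖ := by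
  have : (-A)⁻¹ = -A⁻¹ := Matrix.inv_eq_right_inv (by
    rw [neg_mul_neg, Matrix.mul_nonsing_inv _ (isUnit_iff_ne_zero.2 hA)])
  rw [this, norm_neg]

lemma _root_.Matrix.det_ne_zero_of_neg {A : Matrix (Fin n) (Fin n) ℝ} (hA : (-A).det ≠ 0) :
    A.det ≠ 0 := by
  rw [Matrix.det_neg] at hA
  exact right_ne_zero_of_mul hA

lemma DelayData.IsDominatedBy.symbol_nonneg {h : ℝ} (hh : 0 < h) (r : Fin m → ℝ)
    {D D' : DelayData n m} (hd : D.IsDominatedBy h D') (lam : ℝ) {i j : Fin n} (hij : i ≠ j) :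
    0 ≤ D.symbol h r lam i j := by
  rw [DelayData.symbol, Matrix.of_apply]
  refine add_nonneg (add_nonneg (hd.metzler i j hij) (Finset.sum_nonneg fun l _ =>
    mul_nonneg (hd.A_nonneg l i j) (Real.exp_pos _).le)) ?_
  exact intervalIntegral.integral_nonneg (by linarith) fun θ hθ =>
    mul_nonneg (hd.B_nonneg θ hθ i j) (Real.exp_pos _).le

lemma DelayData.IsDominatedBy.neg_H_nonpos {h : ℝ} (hh : 0 < h) {r : Fin m → ℝ}
    {D D' : DelayData n m} (hd : D.IsDominatedBy h D') {i j : Fin n} (hij : i ≠ j) :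
    (-D.H h) i j ≤ 0 := by
  have := hd.symbol_nonneg hh r 0 hij
  rw [DelayData.symbol_zero] at this
  simpa using this

/-- For an exponentially stable positive system, `-H` is a nonsingular M-matrix. -/
lemma DelayData.neg_H_inv_nonneg {h : ℝ} (hh : 0 < h) {r : Fin m → ℝ}
    (hr : ∀ i, 0 ≤ r i ∧ r i ≤ h) {D : DelayData n m} (hD : D.IsContinuous h)
    (hd : D.IsDominatedBy h D) (hstab : IsExpStable h (fun _ => D.rhs h r)) :
    (-D.H h).det ≠ 0 ∧ ∀ i j, 0 ≤ (-D.H h)⁻¹ i j := by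
  have hdet : ∀ lam, 0 ≤ lam → (lam • (1 : Matrix (Fin n) (Fin n) ℝ) - D.symbol h r lam).det ≠ 0 := by
    intro lam hlam h0
    obtain ⟨v, hv, hZv⟩ := Matrix.exists_mulVec_eq_zero_iff.2 h0
    rw [Matrix.sub_mulVec, Matrix.smul_mulVec, Matrix.one_mulVec, sub_eq_zero] at hZv
    exact DelayData.not_isExpStable_of_symbol_eigenvector hh r hD hlam hv hZv.symm hstab
  -- `Λ` exceeds the row sums of `H`. As `e^{Λθ} ≤ 1` on `[-h, 0]`, it also exceeds those of
  -- `symbol(Λ)`, so the vector `1` certifies the start of the path.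
  obtain ⟨Λ, hΛ0, hΛ⟩ : ∃ Λ : ℝ, 0 ≤ Λ ∧ ∀ i, (D.H h).mulVec 1 i < Λ := by
    refine ⟨‖(D.H h).mulVec 1‖ + 1, by positivity, fun i => ?_⟩
    exact lt_of_le_of_lt ((le_abs_self _).trans (norm_le_pi_norm ((D.H h).mulVec 1) i))
      (lt_add_one _)
  let W : ℝ → Matrix (Fin n) (Fin n) ℝ := fun t =>
    (Λ - t) • (1 : Matrix (Fin n) (Fin n) ℝ) - D.symbol h r (Λ - t)
  have hWΛ : W Λ = -D.H h := by
    simp [W, DelayData.symbol_zero]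
  rw [← hWΛ]
  refine ⟨hdet _ (by simp), inv_nonneg_of_path (p := 1) (W := W) ?_ hΛ0 ?_ ?_ ?_ ?_⟩
  · have := (DelayData.continuous_symbol hh r hD).comp (continuous_const.sub continuous_id : Continuous fun t => Λ - t)
    exact ((continuous_const.sub continuous_id).smul continuous_const).sub this
  · intro t _ i j hij
    have := hd.symbol_nonneg hh r (Λ - t) hij
    simpa [W, Matrix.one_apply_ne hij] using this
  · exact fun t ht => hdet _ (sub_nonneg.2 ht.2)
  · exact fun i => one_pos
  · intro i
    have h1 := hd.rhs_le hh hr hD hD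
      (y := fun θ => (1 * Real.exp (Λ * θ)) • (1 : Fin n → ℝ))
      (z := fun θ => (1 * Real.exp (0 * θ)) • (1 : Fin n → ℝ))
      (DelayData.continuousOn_exp_smul _ _ _ _) (DelayData.continuousOn_exp_smul _ _ _ _)
      (fun θ hθ j => by
        simpa using mul_nonpos_of_nonneg_of_nonpos hΛ0 hθ.2) (s := 1) (by simp) (i := i) (by simp)
    rw [DelayData.rhs_exp_smul hh r hD, DelayData.rhs_exp_smul hh r hD,
      DelayData.symbol_zero] at h1
    simp only [one_smul, one_mul] at h1
    have h2 := hΛ i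
    simp only [W, sub_zero, Matrix.sub_mulVec, Matrix.smul_mulVec, Matrix.one_mulVec,
      Pi.sub_apply, Pi.smul_apply, Pi.one_apply, smul_eq_mul, mul_one]
    linarith

/-- The domination carries over to the action of `H` on positive vectors. -/
lemma DelayData.IsDominatedBy.H_mulVec_le {h : ℝ} (hh : 0 < h) {r : Fin m → ℝ}
    (hr : ∀ i, 0 ≤ r i ∧ r i ≤ h) {D D' : DelayData n m} (hD : D.IsContinuous h)
    (hD' : D'.IsContinuous h) (hd : D.IsDominatedBy h D') {p : Fin n → ℝ} (hp : ∀ i, 0 < p i)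
    (i : Fin n) : (D.H h).mulVec p i ≤ (D'.H h).mulVec p i := by
  have h1 := hd.rhs_le hh hr hD hD'
    (y := fun θ => (1 * Real.exp (0 * θ)) • p) (z := fun θ => (1 * Real.exp (0 * θ)) • p)
    (DelayData.continuousOn_exp_smul _ _ _ _) (DelayData.continuousOn_exp_smul _ _ _ _)
    (fun θ hθ j => by simp [abs_of_pos (hp j)]) (s := 1) (by simp) (i := i) (by simp)
  rwa [DelayData.rhs_exp_smul hh r hD, DelayData.rhs_exp_smul hh r hD', DelayData.symbol_zero,
    DelayData.symbol_zero, one_smul, one_smul, one_mul] at h1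

/-- Uniform decay for all time-dependent right-hand sides which differ by at most `ρ` from systems
dominated by `D₀`, as long as `ρ ‖p‖ < 1` where `H₀ p = -1`. -/
lemma exists_uniform_decay (hn : 0 < n) {h : ℝ} (hh : 0 < h) {r : Fin m → ℝ}
    (hr : ∀ i, 0 ≤ r i ∧ r i ≤ h) {D₀ : DelayData n m} (hD₀ : D₀.IsContinuous h)
    {p : Fin n → ℝ} (hp : ∀ i, 0 < p i) (hHp : ∀ i, (D₀.H h).mulVec p i = -1) {ρ : ℝ}
    (hρ : ρ * ‖p‖ < 1) :
    ∃ M > 0, ∃ α > 0, ∀ G : ℝ → (ℝ → Fin n → ℝ) → (Fin n → ℝ),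
      (∀ t, 0 ≤ t → ∃ D : DelayData n m, D.IsContinuous h ∧ D.IsDominatedBy h D₀ ∧
        ∀ y : ℝ → Fin n → ℝ, ContinuousOn y (Set.Icc (-h) 0) → ∀ K,
          (∀ θ ∈ Set.Icc (-h) 0, ∀ j, |y θ j| ≤ K) → ∀ i, |G t y i - D.rhs h r y i| ≤ ρ * K) →
      HasDecay h G M α := by
  obtain ⟨α, hα, hineq⟩ : ∃ α > 0, ∀ i, (D₀.symbol h r (-α)).mulVec p i +
      ρ * (Real.exp (α * h) * ‖p‖) + α * p i < 0 := by
    -- At `α = 0` the inequality reads `-1 + ρ ‖p‖ < 0`; continuity gives a small positive rate.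
    have hev : ∀ᶠ α in nhds (0 : ℝ), ∀ i, (D₀.symbol h r (-α)).mulVec p i +
        ρ * (Real.exp (α * h) * ‖p‖) + α * p i < 0 := by
      refine Filter.eventually_all.2 fun i => ?_
      have hs : Continuous fun α : ℝ => (D₀.symbol h r (-α)).mulVec p i :=
        (continuous_apply i).comp
          (((DelayData.continuous_symbol hh r hD₀).comp continuous_neg).matrix_mulVec
            continuous_const)
      have hc : Continuous fun α : ℝ => (D₀.symbol h r (-α)).mulVec p i +
          ρ * (Real.exp (α * h) * ‖p‖) + α * p i :=
        (hs.add (by fun_prop)).add (by fun_prop)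
      refine hc.continuousAt.eventually_lt_const ?_
      simp only [neg_zero, DelayData.symbol_zero, hHp, zero_mul, Real.exp_zero, one_mul]
      linarith
    obtain ⟨α, h1, h2⟩ := ((hev.filter_mono nhdsWithin_le_nhds).and
      (self_mem_nhdsWithin (s := Set.Ioi (0 : ℝ)))).exists
    exact ⟨α, h2, h1⟩
  have hterm : ∀ i ∈ Finset.univ, 0 ≤ (p i)⁻¹ := fun i _ => (inv_pos.2 (hp i)).le
  have hq : ∀ i, 1 ≤ (∑ i, (p i)⁻¹) * p i := fun i => by
    rw [← div_le_iff₀ (hp i), one_div]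
    exact Finset.single_le_sum hterm (Finset.mem_univ i)
  have hp0 : 0 < ‖p‖ :=
    (hp ⟨0, hn⟩).trans_le ((le_abs_self _).trans (norm_le_pi_norm p _))
  refine ⟨(∑ i, (p i)⁻¹) * ‖p‖, mul_pos (Finset.sum_pos (fun i _ => inv_pos.2 (hp i))
    ⟨⟨0, hn⟩, Finset.mem_univ _⟩) hp0, α, hα, fun G hG => ?_⟩
  refine hasDecay_of_inward hh hp hq (Finset.sum_nonneg hterm) hα fun t ht y hy C hC hyC s hs i hi => ?_
  obtain ⟨D, hD, hd, hGD⟩ := hG t ht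
  -- The box at delay `h` is larger by `e^{αh}`, which is the factor carried by `ρ` in the choice of
  -- `α`.
  have hyK : ∀ θ ∈ Set.Icc (-h) 0, ∀ j, |y θ j| ≤ C * (Real.exp (α * h) * ‖p‖) := by
    intro θ hθ j
    refine (hyC θ hθ j).trans ?_
    rw [mul_assoc]
    refine mul_le_mul_of_nonneg_left (mul_le_mul ?_ ?_ (hp j).le (Real.exp_pos _).le) hC.le
    · exact Real.exp_le_exp.2 (by nlinarith [hθ.1])
    · exact (le_abs_self _).trans (norm_le_pi_norm p j)
  have h1 := hd.rhs_le hh hr hD hD₀ hy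
    (DelayData.continuousOn_exp_smul C (-α) p (Set.Icc (-h) 0)) hyC hs (i := i) (by simpa using hi)
  rw [DelayData.rhs_exp_smul hh r hD₀, Pi.smul_apply, smul_eq_mul] at h1
  have h2 : s * (G t y i - D.rhs h r y i) ≤ ρ * (C * (Real.exp (α * h) * ‖p‖)) := by
    refine (le_abs_self _).trans ?_
    rw [abs_mul, hs, one_mul]
    exact hGD y hy _ hyK i
  have h3 := mul_neg_of_pos_of_neg hC (hineq i)
  linarith

lemma abs_stieltjes_perturbation_le {h : ℝ} (hh : 0 < h) {Δ : Matrix (Fin n) (Fin n) ℝ}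
    {δ : ℝ → Matrix (Fin n) (Fin n) ℝ}
    (hδ : ∀ i j, BoundedVariationOn (fun θ => δ θ i j) (Set.Icc (-h) 0))
    {y : ℝ → Fin n → ℝ} (hy : ContinuousOn y (Set.Icc (-h) 0)) {K : ℝ}
    (hK : ∀ θ ∈ Set.Icc (-h) 0, ∀ j, |y θ j| ≤ K) (i : Fin n) :
    |Δ.mulVec (y 0) i + ∑ j, rsIntegral (-h) 0 (fun θ => δ θ i j) (fun θ => y θ j)| ≤
      (‖Δ‖ + nbvNorm h δ) * K := by
  have hle : -h ≤ 0 := by linarith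
  have h0 : (0 : ℝ) ∈ Set.Icc (-h) 0 := ⟨hle, le_rfl⟩
  have hK0 : 0 ≤ K := (abs_nonneg _).trans (hK 0 h0 i)
  rw [add_mul]
  refine (abs_add_le _ _).trans (add_le_add ?_ ?_)
  · have h1 : ‖y 0‖ ≤ K := (pi_norm_le_iff_of_nonneg hK0).2 fun j => hK 0 h0 j
    exact (norm_le_pi_norm (Δ.mulVec (y 0)) i).trans ((Matrix.linfty_opNorm_mulVec _ _).trans
      (mul_le_mul_of_nonneg_left h1 (norm_nonneg _)))
  · calc _ ≤ ∑ j, |rsIntegral (-h) 0 (fun θ => δ θ i j) (fun θ => y θ j)| :=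
          Finset.abs_sum_le_sum_abs _ _
      _ ≤ ∑ j, (eVariationOn (fun θ => δ θ i j) (Set.Icc (-h) 0)).toReal * K := by
          refine Finset.sum_le_sum fun j _ => ?_
          obtain ⟨I, hI⟩ := exists_isRSIntegral hle (hδ i j) (continuousOn_pi.1 hy j)
          rw [hI.rsIntegral_eq hle]
          exact hI.abs_le hle (hδ i j) fun θ hθ => hK θ hθ j
      _ ≤ nbvNorm h δ * K := by
          rw [← Finset.sum_mul]
          exact mul_le_mul_of_nonneg_right (le_ciSup (f := fun i => ∑ j,
            (eVariationOn (fun θ => δ θ i j) (Set.Icc (-h) 0)).toReal)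
            (Set.finite_range _).bddAbove i) hK0

/-- Robustness: perturbations smaller than `1 / ‖p‖`, where `H₀ p = -1`, preserve exponential
stability of a switched system dominated by `D₀`. -/
lemma isExpStable_of_small_perturbation {N : ℕ} (hn : 0 < n) {h : ℝ} (hh : 0 < h) {r : Fin m → ℝ}
    (hr : ∀ i, 0 ≤ r i ∧ r i ≤ h) {D₀ : DelayData n m} (hD₀ : D₀.IsContinuous h)
    {D : Fin N → DelayData n m} (hD : ∀ k, (D k).IsContinuous h)
    (hdom : ∀ k, (D k).IsDominatedBy h D₀)
    {p : Fin n → ℝ} (hp : ∀ i, 0 < p i) (hHp : ∀ i, (D₀.H h).mulVec p i = -1)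
    {Δ : Fin N → Matrix (Fin n) (Fin n) ℝ} {δ : Fin N → ℝ → Matrix (Fin n) (Fin n) ℝ}
    (hδ : ∀ k i j, BoundedVariationOn (fun θ => δ k θ i j) (Set.Icc (-h) 0))
    (hsmall : (⨆ k, (‖Δ k‖ + nbvNorm h (δ k))) < 1 / ‖p‖) (σ : ℝ → Fin N) :
    IsExpStable h (fun t => stieltjesRhs h ((D (σ t)).A0 + Δ (σ t))
      ((D (σ t)).kernel h r + δ (σ t))) := by
  have hp0 : 0 < ‖p‖ :=
    (hp ⟨0, hn⟩).trans_le ((le_abs_self _).trans (norm_le_pi_norm p _))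
  rw [lt_div_iff₀ hp0] at hsmall
  obtain ⟨M, hM, α, hα, H⟩ := exists_uniform_decay hn hh hr hD₀ hp hHp hsmall
  refine ⟨M, hM, α, hα, H _ fun t _ => ⟨D (σ t), hD _, hdom _, fun y hy K hK i => ?_⟩⟩
  rw [DelayData.stieltjesRhs_kernel_add_apply hh hr (hD _) (hδ _) hy, add_sub_cancel_left]
  have hK0 : 0 ≤ K := (abs_nonneg _).trans (hK 0 ⟨by linarith, le_rfl⟩ i)
  exact (abs_stieltjes_perturbation_le hh (hδ _) hy hK i).trans (mul_le_mul_of_nonneg_right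
    (le_ciSup (f := fun k => ‖Δ k‖ + nbvNorm h (δ k)) (Set.finite_range _).bddAbove (σ t)) hK0)

/-- A smallest destabilizing perturbation of a matrix `A` with `(-A)⁻¹ ≥ 0`. -/
lemma exists_singular_perturbation (hn : 0 < n) {A : Matrix (Fin n) (Fin n) ℝ}
    (hdet : (-A).det ≠ 0) (hinv : ∀ i j, 0 ≤ (-A)⁻¹ i j) :
    ∃ Δ : Matrix (Fin n) (Fin n) ℝ, ‖Δ‖ = 1 / ‖A⁻¹‖ ∧
      ∃ v ≠ 0, (A + Δ).mulVec v = 0 := by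
  have : Nonempty (Fin n) := ⟨⟨0, hn⟩⟩
  set w := (-A)⁻¹.mulVec 1 with hw
  have hAw : A.mulVec w = -1 := by
    have : (-A).mulVec w = 1 := by
      rw [hw, Matrix.mulVec_mulVec, Matrix.mul_nonsing_inv _ (isUnit_iff_ne_zero.2 hdet),
        Matrix.one_mulVec]
    rw [← this, Matrix.neg_mulVec, neg_neg]
  have hw0 : ∀ i, 0 ≤ w i := fun i => by
    simp only [hw, Matrix.mulVec, dotProduct, Pi.one_apply, mul_one]
    exact Finset.sum_nonneg fun k _ => hinv i k
  have hwne : w ≠ 0 := by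
    intro h0
    rw [h0, Matrix.mulVec_zero] at hAw
    simpa using congrFun hAw ⟨0, hn⟩
  have hnorm : ‖A⁻¹‖ = ‖w‖ := by
    rw [← Matrix.norm_inv_neg A (Matrix.det_ne_zero_of_neg hdet), norm_eq_norm_mulVec_one hinv]
  obtain ⟨i, hi⟩ : ∃ i, w i = ‖w‖ := by
    obtain ⟨i, hi⟩ := Finite.exists_max w
    refine ⟨i, le_antisymm ((le_abs_self _).trans (norm_le_pi_norm w i)) ?_⟩
    refine (pi_norm_le_iff_of_nonneg (hw0 i)).2 fun j => ?_
    rw [Real.norm_of_nonneg (hw0 j)]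
    exact hi j
  have hpos : 0 < ‖w‖ := norm_pos_iff.2 hwne
  -- `Δ` has the single nonzero column `i`, where `w_i = ‖w‖`, so `Δ w = 1 = -A w`.
  refine ⟨Matrix.of fun _ j => if j = i then 1 / ‖w‖ else 0, ?_, w, hwne, ?_⟩
  · rw [hnorm, Matrix.linfty_opNorm_def]
    simp [apply_ite, Finset.sup_const]
  · rw [Matrix.add_mulVec, hAw]
    ext a
    simp [Matrix.mulVec, dotProduct, hi, hpos.ne']

lemma isSwitchingSignal_const {N : ℕ} (k : Fin N) : IsSwitchingSignal (fun _ : ℝ => k) :=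
  ⟨1, one_pos, fun j => j, by simp, fun j => by simp, fun _ _ _ => rfl⟩

lemma DelayData.kernel_eq_zero (h : ℝ) (r : Fin m → ℝ) (Δ : Matrix (Fin n) (Fin n) ℝ) :
    DelayData.kernel h r ⟨Δ, 0, 0⟩ = 0 := by
  ext θ i j
  simp [DelayData.kernel_apply]

lemma DelayData.H_perturb_A0 (h : ℝ) (D : DelayData n m) (Δ : Matrix (Fin n) (Fin n) ℝ) :
    (D.perturb ⟨Δ, 0, 0⟩).H h = D.H h + Δ := by
  simp only [DelayData.H, DelayData.perturb, add_zero]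
  abel

/-- The singular perturbation of `H_k` destabilizes the `k`-th subsystem. -/
lemma exists_destabilizing_perturbation {N : ℕ} (hn : 0 < n) {h : ℝ} (hh : 0 < h) (r : Fin m → ℝ)
    {D : Fin N → DelayData n m} (hD : ∀ k, (D k).IsContinuous h) (k : Fin N)
    (hdet : (-(D k).H h).det ≠ 0) (hinv : ∀ i j, 0 ≤ (-(D k).H h)⁻¹ i j) :
    ∃ Δ : Fin N → Matrix (Fin n) (Fin n) ℝ, (⨆ l, (‖Δ l‖ + 0)) = 1 / ‖((D k).H h)⁻¹‖ ∧
      ¬ IsExpStable h (fun _ => ((D k).perturb ⟨Δ k, 0, 0⟩).rhs h r) := by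
  have : Nonempty (Fin N) := ⟨k⟩
  obtain ⟨Δ, hΔ, v, hv, hHv⟩ := exists_singular_perturbation hn hdet hinv
  refine ⟨Pi.single k Δ, ?_, ?_⟩
  · rw [← hΔ]
    simp only [add_zero]
    apply le_antisymm
    · refine ciSup_le fun l => ?_
      rcases eq_or_ne l k with rfl | hl
      · simp
      · simp [hl]
    · refine le_trans (by simp) (le_ciSup (f := fun l =>
        ‖(Pi.single k Δ : Fin N → Matrix (Fin n) (Fin n) ℝ) l‖) (Set.finite_range _).bddAbove k)
  -- The eigenvalue is `lam = 0`: `v` is a constant solution of the perturbed subsystem.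
  · refine DelayData.not_isExpStable_of_symbol_eigenvector hh r
      ((hD k).perturb fun i j => continuousOn_const) le_rfl hv ?_
    rw [DelayData.symbol_zero, DelayData.H_perturb_A0, Pi.single_eq_same, hHv, zero_smul]

end DelaySwitched

end

/-! ### Proof of the corollary -/

theorem mainTheorem4 (n m N : ℕ) (hn : 0 < n) (hN : 0 < N) (h : ℝ) (hh : 0 < h)
    (r : Fin m → ℝ) (hr : ∀ i, 0 ≤ r i ∧ r i ≤ h)
    (D₀ : DelaySwitched.DelayData n m) (hD₀ : D₀.IsContinuous h)
    (hpos : DelaySwitched.IsPositive h (fun _ => D₀.rhs h r))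
    (hstab : DelaySwitched.IsExpStable h (fun _ => D₀.rhs h r))
    (D : Fin N → DelaySwitched.DelayData n m) (hD : ∀ k, (D k).IsContinuous h)
    (hdom : ∀ k, (D k).IsDominatedBy h D₀) :
    DelaySwitched.IsExpStableArbitrarySwitching h (fun k => (D k).rhs h r) ∧
    IsUnit (D₀.H h) ∧ (∀ k, IsUnit ((D k).H h)) ∧
    (1 / ‖(D₀.H h)⁻¹‖ ≤
        DelaySwitched.stabilityRadius h (fun k => (D k).A0) (fun k => (D k).kernel h r) ∧
      DelaySwitched.stabilityRadius h (fun k => (D k).A0) (fun k => (D k).kernel h r) ≤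
        1 / (⨆ k, ‖((D k).H h)⁻¹‖)) ∧
    (1 / ‖(D₀.H h)⁻¹‖ ≤ DelaySwitched.DelayData.coefficientRadius h r D ∧
      DelaySwitched.DelayData.coefficientRadius h r D ≤ 1 / (⨆ k, ‖((D k).H h)⁻¹‖)) := by
  open DelaySwitched in
  have : Nonempty (Fin N) := ⟨⟨0, hN⟩⟩
  have hd₀ : D₀.IsDominatedBy h D₀ := (hdom ⟨0, hN⟩).refl_right
  obtain ⟨hdet₀, hinv₀⟩ := DelayData.neg_H_inv_nonneg hh hr hD₀ hd₀ hstab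
  set p := (-D₀.H h)⁻¹.mulVec 1 with hpdef
  have hp : ∀ i, 0 < p i := inv_mulVec_one_pos (fun i j hij => hd₀.neg_H_nonpos (r := r) hh hij) hdet₀ hinv₀
  have hHp' : ∀ i, (-D₀.H h).mulVec p i = 1 := fun i => by
    rw [hpdef, Matrix.mulVec_mulVec, Matrix.mul_nonsing_inv _ (isUnit_iff_ne_zero.2 hdet₀),
      Matrix.one_mulVec, Pi.one_apply]
  have hHp : ∀ i, (D₀.H h).mulVec p i = -1 := fun i => by
    rw [← hHp' i, Matrix.neg_mulVec, Pi.neg_apply, neg_neg]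
  have hnorm : ‖(D₀.H h)⁻¹‖ = ‖p‖ := by
    rw [← Matrix.norm_inv_neg _ (Matrix.det_ne_zero_of_neg hdet₀), norm_eq_norm_mulVec_one hinv₀]
  have hZ : ∀ k i j, i ≠ j → (-(D k).H h) i j ≤ 0 := fun k i j hij =>
    (hdom k).neg_H_nonpos (r := r) hh hij
  -- The same `p` certifies every subsystem: `(-H_k) p ≥ (-H₀) p = 1`.
  have hZp : ∀ k i, 0 < (-(D k).H h).mulVec p i := fun k i => by
    have := (hdom k).H_mulVec_le hh hr (hD k) hD₀ hp i
    rw [Matrix.neg_mulVec, Pi.neg_apply]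
    linarith [hHp i]
  have hdet : ∀ k, (-(D k).H h).det ≠ 0 := fun k => det_ne_zero_of_zMatrix (hZ k) hp (hZp k)
  -- Destabilizing the subsystem with the largest `‖H_k⁻¹‖`, under the constant signal `k`, gives
  -- both upper bounds.
  obtain ⟨k, hk⟩ := exists_eq_ciSup_of_finite (f := fun k => ‖((D k).H h)⁻¹‖)
  obtain ⟨Δ, hΔ, hunst⟩ := exists_destabilizing_perturbation hn hh r hD k (hdet k)
    (inv_nonneg_of_zMatrix (hZ k) hp (hZp k))
  have hP : ∀ l, (⟨Δ l, 0, 0⟩ : DelayData n m).IsContinuous h := fun l i j => continuousOn_const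
  refine ⟨?_, ?_, fun k => ?_, ?_, ?_⟩
  · obtain ⟨M, hM, α, hα, H⟩ := exists_uniform_decay hn hh hr hD₀ hp hHp (ρ := 0) (by simp)
    exact ⟨M, hM, α, hα, fun σ _ => H _ fun t _ =>
      ⟨D (σ t), hD _, hdom _, fun y _ K _ i => by simp⟩⟩
  · exact (Matrix.isUnit_iff_isUnit_det _).2
      (isUnit_iff_ne_zero.2 (Matrix.det_ne_zero_of_neg hdet₀))
  · exact (Matrix.isUnit_iff_isUnit_det _).2
      (isUnit_iff_ne_zero.2 (Matrix.det_ne_zero_of_neg (hdet k)))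
  · rw [← hk, ← hΔ, hnorm, stabilityRadius]
    set S := {ρ : ℝ | ∃ (Δ : Fin N → Matrix (Fin n) (Fin n) ℝ)
      (δ : Fin N → ℝ → Matrix (Fin n) (Fin n) ℝ), (∀ k, IsNBV h (δ k)) ∧
      ρ = (⨆ k, (‖Δ k‖ + nbvNorm h (δ k))) ∧
      ∃ σ : ℝ → Fin N, IsSwitchingSignal σ ∧ ¬ IsExpStable h (fun t =>
        stieltjesRhs h ((D (σ t)).A0 + Δ (σ t)) ((D (σ t)).kernel h r + δ (σ t)))}
    have hmem : (⨆ l, (‖Δ l‖ + 0)) ∈ S := by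
      refine ⟨Δ, fun _ => 0, fun _ => isNBV_zero h, by simp only [nbvNorm_zero], fun _ => k,
        isSwitchingSignal_const k, fun hst => hunst (hst.congr fun t y hy => ?_)⟩
      rw [DelayData.rhs_perturb hh hr (hD k) (hP k) hy, DelayData.kernel_eq_zero]
    have hlow : ∀ ρ ∈ S, 1 / ‖p‖ ≤ ρ := by
      rintro ρ ⟨Δ', δ, hδ, rfl, σ, -, hns⟩
      by_contra! hlt
      exact hns (isExpStable_of_small_perturbation hn hh hr hD₀ hD hdom hp hHp
        (fun k i j => (hδ k i j).1) hlt σ)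
    -- The real `sInf` needs both facts each way: `hmem` gives nonemptiness for the lower bound,
    -- `hlow` boundedness below for the upper one.
    exact ⟨le_csInf ⟨_, hmem⟩ hlow, csInf_le ⟨_, hlow⟩ hmem⟩
  · rw [← hk, ← hΔ, hnorm, DelayData.coefficientRadius]
    set S := {ρ : ℝ | ∃ P : Fin N → DelayData n m, (∀ k, (P k).IsContinuous h) ∧
      ρ = (⨆ k, (‖(P k).A0‖ + nbvNorm h ((P k).kernel h r))) ∧
      ∃ σ : ℝ → Fin N, IsSwitchingSignal σ ∧
        ¬ IsExpStable h (fun t => ((D (σ t)).perturb (P (σ t))).rhs h r)}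
    have hmem : (⨆ l, (‖Δ l‖ + 0)) ∈ S := by
      refine ⟨fun l => ⟨Δ l, 0, 0⟩, hP, ?_, fun _ => k, isSwitchingSignal_const k, hunst⟩
      simp only [DelayData.kernel_eq_zero, nbvNorm_zero]
    have hlow : ∀ ρ ∈ S, 1 / ‖p‖ ≤ ρ := by
      rintro ρ ⟨P, hPc, rfl, σ, -, hns⟩
      by_contra! hlt
      refine hns ((isExpStable_of_small_perturbation hn hh hr hD₀ hD hdom hp hHp
        (fun k i j => DelayData.boundedVariationOn_kernel hh r (hPc k) i j) hlt σ).congr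
        fun t y hy => ?_)
      rw [DelayData.rhs_perturb hh hr (hD _) (hPc _) hy]
    exact ⟨le_csInf ⟨_, hmem⟩ hlow, csInf_le ⟨_, hlow⟩ hmem⟩
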